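/- **Setting.** Let $(\mathsf{Gen},\mathsf{Enc},\mathsf{Dec})$ be the key generation, the encryption, and the decryption of classical ciphertexts of a quantum homomorphic encryption scheme (homomorphic evaluation plays no role here) that is IND-CPA secure, with an encryption oracle, against polynomial-size quantum circuit families. All objects below depend on the security parameter $\lambda$; $n=n(\lambda)$ is a number of qubits. Let $\mu<1$ be a constant, $S\subseteq\{0,1\}^n$ a nonempty $\mu$-biased set, i.e. $|\mathbb E_{a\in S}(-1)^{a\cdot b}|\le\mu$ for all $b\ne 0$, and $D$ a probability distribution on $\{\mathbb 1,X,Z\}^n$. For $w\in\{\mathbb 1,X,Z\}^n$ and $a\in\{0,1\}^n$ put $\sigma_w(a)=\bigotimes_i\sigma_{w_i}^{a_i}$, where $\sigma_{\mathbb 1}=\mathbb 1$. *Pauli braiding test.* The verifier picks $a,b\in S$ uniformly and independently. (i) If $a\cdot b=0$ (mod 2): Alice is asked $(\mathsf{com},a,b)$ and answers two bits $u_a,u_b$. Bob is asked a uniformly random $W\in\{X,Z\}$ and answers $v\in\{0,1\}^n$. Accept iff $a\cdot v=u_a$ (if $W=Z$), respectively $b\cdot v=u_b$ (if $W=X$).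 (ii) If $a\cdot b=1$: the verifier picks a uniformly random cell $j$ of a $3\times3$ grid, and with probability $1/2$ each the row or the column $\ell$ containing $j$. Alice is asked $(\mathsf{MS},a,b,\ell)$ and answers one bit for each of the three cells of $\ell$. If $j$ is the top centre cell, Bob is asked $Z$, answers $v\in\{0,1\}^n$, and his bit is $a\cdot v$; if $j$ is the centre left cell, Bob is asked $X$, answers $v\in\{0,1\}^n$, and his bit is $b\cdot v$; otherwise he is asked $(\mathsf{MS},a,b,j)$ and answers one bit. Accept iff the sum of Alice's three bits is even (if $\ell$ is a row), odd (if $\ell$ is a column), and Bob's bit equals Alice's bit for the cell $j$. *Mixed-versus-pure basis test.* Alice is asked a uniformly random $W\in\{X,Z\}$ and answers $u\in\{0,1\}^n$. With probability $1/2$ Bob is asked the same $W$ and answers $v\in\{0,1\}^n$; accept iff $u=v$. With probability $1/2$ Bob is asked $w\sim D$ and answers $v\in\{0,1\}^n$; accept iff $u_i=v_i$ for all $i$ with $w_i=W$. Let $\mathcal Q_A$ be the set of Alice questions: all $(\mathsf{com},a,b)$ and $(\mathsf{MS},a,b,\ell)$ with $a,b\in S$ and $\ell$ a row or column, $X$,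 $Z$, all $w\in\{\mathbb 1,X,Z\}^n$, and one further question $\mathsf{tele}$. Questions are encoded as messages of a common length polynomial in $\lambda$. In the *compiled* version of a test a single prover receives $c\leftarrow\mathsf{Enc}_{sk}(x)$, where $sk\leftarrow\mathsf{Gen}(1^\lambda)$ and $x$ is Alice's question, replies $\alpha$, receives Bob's question $y$ in the clear, and replies $v$; the verifier evaluates the acceptance condition on Alice's answer $\mathsf{Dec}_{sk}(\alpha)$ and Bob's answer $v$. A prover is given by a pure state $|\psi\rangle$ on a space $\mathcal H$ of finitely many qubits; operators $A^c_\alpha$, each a projector of a projective measurement $\{\Pi^c_\alpha\}_\alpha$ followed by a unitary depending on $c$ and $\alpha$; and projective measurements $\{B^y_v\}_v$. It is *efficient* if the number of qubits is polynomial in $\lambda$ and all of these are implemented by circuits of one- and two-qubit gates of size polynomial in $\lambda$ (for Alice's part, one circuit reading $c$ and one reading $c,\alpha$). The prover learns $sk$ only through $c$. For $q\in\mathcal Q_A$ let $$\psi^{\mathsf{Enc}(q)}=\mathbb E_{sk\leftarrow\mathsf{Gen}(1^\lambda)}\,\mathbb E_{c\leftarrow\mathsf{Enc}_{sk}(q)}\sum_\alpha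 A^c_\alpha|\psi\rangle\langle\psi|(A^c_\alpha)^\dagger .$$ For $w\in\{\mathbb 1,X,Z\}^n$ let $M^w_u$ be Bob's measurement on question $w$ in which the answer bits at positions $i$ with $w_i=\mathbb 1$ (ignored by the verifier) are replaced by $0$, and $O^w(a)=\sum_u(-1)^{a\cdot u}M^w_u$. Write $\|A\|_\rho^2=\mathrm{Tr}[A^\dagger A\rho]$. **Theorem.** For every $\mu<1$ there is a constant $C$ depending only on $\mu$ such that the following holds. Suppose an efficient prover wins, for every $\lambda$, the compiled Pauli braiding test and the compiled mixed-versus-pure basis test each with probability at least $1-\varepsilon(\lambda)$. Then there is a negligible function $\eta$ such that for every $\lambda$ there are a finite-dimensional Hilbert space $\mathcal H_{\rm aux}$ and an isometry $V:\mathcal H\to\mathbb C^{2^n}\otimes\mathcal H_{\rm aux}$ with, for every Alice question $q\in\mathcal Q_A$, $$\mathbb E_{w\sim D}\ \mathbb E_{a\in\{0,1\}^n}\ \big\|O^w(a)-V^\dagger(\sigma_w(a)\otimes\mathbb 1_{\rm aux})V\big\|^2_{\psi^{\mathsf{Enc}(q)}}\ \le\ C\sqrt{\varepsilon(\lambda)}+\eta(\lambda).$$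 -/

import Mathlib

open scoped Matrix Kronecker

noncomputable section

/-! ### Bits, expectations, asymptotics -/

/-- Bits, with addition modulo two. -/
abbrev Bit := ZMod 2

/-- Bit strings of length `n`; `a ⬝ᵥ b` is the inner product modulo two. -/
abbrev Bits (n : ℕ) := Fin n → Bit

/-- The sign `(-1)^b`. -/
def sgn (b : Bit) : ℂ := if b = 0 then 1 else -1

/-- Expectation `𝔼_{x ∼ p} f x` over a finite type, for real-valued or matrix-valued `f`. -/
def expect {α M : Type} [Fintype α] [AddCommMonoid M] [Module ℝ M] (p : PMF α) (f : α → M) : M :=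
  ∑ x, (p x).toReal • f x

/-- `f` is bounded by a polynomial. -/
def PolyBounded (f : ℕ → ℕ) : Prop := ∃ p : Polynomial ℕ, ∀ lam, f lam ≤ p.eval lam

/-- `f` is negligible: `lam ^ k * f lam → 0` for every `k`. -/
def Negligible (f : ℕ → ℝ) : Prop :=
  Asymptotics.SuperpolynomialDecay Filter.atTop (fun lam : ℕ => (lam : ℝ)) f

/-- A nonempty set `S` of bit strings is `μ`-biased if `|𝔼_{a ∈ S} (-1)^{a·b}| ≤ μ`
for all `b ≠ 0`. -/
def IsBiased {n : ℕ} (μ : ℝ) (S : Finset (Bits n)) : Prop :=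
  ∀ b : Bits n, b ≠ 0 → ‖(∑ a ∈ S, sgn (a ⬝ᵥ b)) / (S.card : ℂ)‖ ≤ μ

/-! ### Pauli operators -/

/-- A letter of a Pauli string. -/
inductive Pauli
  | I
  | X
  | Z
  deriving DecidableEq

instance : Fintype Pauli := ⟨{.I, .X, .Z}, fun x => by cases x <;> simp⟩

/-- The two pure bases. -/
inductive Basis
  | X
  | Z
  deriving DecidableEq

instance : Fintype Basis := ⟨{.X, .Z}, fun x => by cases x <;> simp⟩

instance : Nonempty Basis := ⟨Basis.X⟩

/-- A pure basis as a Pauli letter. -/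
def Basis.toPauli : Basis → Pauli
  | .X => .X
  | .Z => .Z

/-- Pauli strings in `{1, X, Z}^n`. -/
abbrev PauliString (n : ℕ) := Fin n → Pauli

/-- The one-qubit matrices `1`, `σ_X`, `σ_Z`. -/
def Pauli.mat : Pauli → Matrix Bit Bit ℂ
  | .I => 1
  | .X => Matrix.of fun x y => if x = y then 0 else 1
  | .Z => Matrix.diagonal sgn

/-- `σ_w(a) = ⨂_i σ_{w_i}^{a_i}`, a matrix on `n` qubits. -/
def pauliObs {n : ℕ} (w : PauliString n) (a : Bits n) : Matrix (Bits n) (Bits n) ℂ :=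
  Matrix.of fun x y => ∏ i, ((w i).mat ^ (a i).val) (x i) (y i)

/-- The squared state-dependent norm `‖A‖²_ρ = Tr[A† A ρ]`. -/
def stateNormSq {ι : Type} [Fintype ι] (A ρ : Matrix ι ι ℂ) : ℝ := (Aᴴ * A * ρ).trace.re

/-! ### Quantum circuits -/

/-- One- and two-qubit gates on `N` qubits. -/
inductive Gate (N : ℕ)
  | one (i : Fin N) (U : Matrix.unitaryGroup Bit ℂ)
  | two (i j : Fin N) (hij : i ≠ j) (U : Matrix.unitaryGroup (Bit × Bit) ℂ)

/-- The unitary on `N` qubits performed by a gate. -/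
def Gate.mat {N : ℕ} : Gate N → Matrix (Bits N) (Bits N) ℂ
  | .one i U => Matrix.of fun x y =>
      if ∀ k, k ≠ i → x k = y k then U.1 (x i) (y i) else 0
  | .two i j _ U => Matrix.of fun x y =>
      if ∀ k, k ≠ i → k ≠ j → x k = y k then U.1 (x i, x j) (y i, y j) else 0

/-- A gate that is applied always, or only if a given bit of the classical input is `1`. -/
structure Step (k N : ℕ) where
  control : Option (Fin k)
  gate : Gate N

/-- The operation that a step performs on classical input `x`. -/
def Step.mat {k N : ℕ} (s : Step k N) (x : Bits k) : Matrix (Bits N) (Bits N) ℂ :=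
  match s.control with
  | none => s.gate.mat
  | some i => if x i = 1 then s.gate.mat else 1

/-- A quantum circuit on `N` qubits that reads `k` classical input bits. Its size is its length. -/
abbrev Circuit (k N : ℕ) := List (Step k N)

/-- The unitary that a circuit performs on classical input `x`; the head of the list acts first. -/
def Circuit.mat {k N : ℕ} (C : Circuit k N) (x : Bits k) : Matrix (Bits N) (Bits N) ℂ :=
  match C with
  | [] => 1
  | s :: C' => Circuit.mat C' x * s.mat x

/-- The empty classical input. -/
def noInput : Bits 0 := Fin.elim0

/-- The state `|0…0⟩`. -/
def zeroKet (N : ℕ) : Bits N → ℂ := Pi.single 0 1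

/-- The projection onto outcome `v` of a computational-basis measurement of the qubits `reg`. -/
def outcomeProj {r N : ℕ} (reg : Fin r ↪ Fin N) (v : Bits r) : Matrix (Bits N) (Bits N) ℂ :=
  Matrix.diagonal fun x => if ∀ i, x (reg i) = v i then 1 else 0

/-! ### Encryption -/

/-- Key generation, encryption, and decryption of classical ciphertexts of a (quantum homomorphic)
encryption scheme. These are the only parts of the scheme that enter the compiled protocol;
homomorphic evaluation is used by an honest prover only. -/
structure EncryptionScheme where
  /-- length of secret keys -/
  keyLen : ℕ → ℕ
  gen : (lam : ℕ) → PMF (Bits (keyLen lam))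
  /-- length of encryptions of `m`-bit messages -/
  ctLen : ℕ → ℕ → ℕ
  enc : (lam : ℕ) → Bits (keyLen lam) → (m : ℕ) → Bits m → PMF (Bits (ctLen lam m))
  /-- decryption of a classical ciphertext, a string of bits of any length -/
  dec : (lam : ℕ) → Bits (keyLen lam) → List Bit → List Bit

/-- A quantum adversary on `N` qubits with classical memory of `k` bits and access to an
encryption oracle. In each round it applies a circuit controlled by its memory, and then
outputs the outcome of measuring one qubit,
or measures a register and appends the outcome to its memory,
or measures a register, submits the outcome as a message to the oracle, and appends
the ciphertext it receives to its memory. -/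
inductive Adversary (ct : ℕ → ℕ) (N : ℕ) : ℕ → Type
  | output {k : ℕ} (C : Circuit k N) (out : Fin N) : Adversary ct N k
  | measure {k r : ℕ} (C : Circuit k N) (reg : Fin r ↪ Fin N)
      (next : Adversary ct N (k + r)) : Adversary ct N k
  | query {k r : ℕ} (C : Circuit k N) (reg : Fin r ↪ Fin N)
      (next : Adversary ct N (k + ct r)) : Adversary ct N k

/-- The number of operations of an adversary. -/
def Adversary.size {ct : ℕ → ℕ} {N : ℕ} : {k : ℕ} → Adversary ct N k → ℕ
  | _, .output C _ => C.length + 1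
  | _, .measure (r := r) C _ next => C.length + r + 1 + next.size
  | _, .query (r := r) C _ next => C.length + r + 1 + next.size

/-- The probability that the adversary outputs `1` with memory `x`, (subnormalised) state `ψ`
and encryption oracle `enc`. -/
def Adversary.outputProb {ct : ℕ → ℕ} {N : ℕ} (enc : (r : ℕ) → Bits r → PMF (Bits (ct r))) :
    {k : ℕ} → Adversary ct N k → Bits k → (Bits N → ℂ) → ℝ
  | _, .output C out, x, ψ =>
      ∑ z : Bits N, if z out = 1 then ‖(Circuit.mat C x *ᵥ ψ) z‖ ^ 2 else 0
  | _, .measure (r := r) C reg next, x, ψ =>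
      ∑ v : Bits r, next.outputProb enc (Fin.append x v)
        (outcomeProj reg v *ᵥ (Circuit.mat C x *ᵥ ψ))
  | _, .query (r := r) C reg next, x, ψ =>
      ∑ v : Bits r, expect (enc r v) fun c => next.outputProb enc (Fin.append x c)
        (outcomeProj reg v *ᵥ (Circuit.mat C x *ᵥ ψ))

/-- The probability that the adversary outputs `1` when its challenge is an encryption of `x`. -/
def challengeProb (E : EncryptionScheme) (lam : ℕ) {m N : ℕ}
    (A : Adversary (E.ctLen lam) N (E.ctLen lam m)) (x : Bits m) : ℝ :=
  expect (E.gen lam) fun sk => expect (E.enc lam sk m x) fun c =>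
    A.outputProb (E.enc lam sk) c (zeroKet N)

/-- IND-CPA security against polynomial-size quantum adversaries. -/
def EncryptionScheme.IsINDCPA (E : EncryptionScheme) : Prop :=
  ∀ (m : ℕ → ℕ) (x₀ x₁ : (lam : ℕ) → Bits (m lam)) (N : ℕ → ℕ)
    (A : (lam : ℕ) → Adversary (E.ctLen lam) (N lam) (E.ctLen lam (m lam))),
    PolyBounded m → PolyBounded N → PolyBounded (fun lam => (A lam).size) →
    Negligible fun lam =>
      |challengeProb E lam (A lam) (x₀ lam) - challengeProb E lam (A lam) (x₁ lam)|

/-! ### Questions and tests -/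

/-- The cells of the magic square (row, column), numbered from `0`. -/
abbrev Cell := Fin 3 × Fin 3

/-- The rows and columns of the magic square. -/
inductive Line
  | row (i : Fin 3)
  | col (j : Fin 3)
  deriving DecidableEq, Fintype

/-- The `k`-th cell of a line. -/
def Line.cell : Line → Fin 3 → Cell
  | .row i, k => (i, k)
  | .col j, k => (k, j)

/-- The sum modulo two that Alice's three answers must have: even on rows, odd on columns. -/
def Line.parity : Line → Bit
  | .row _ => 0
  | .col _ => 1

/-- Alice questions. An element `a` of `S` stands for the seed `r_a` that indexes it. -/
inductive AliceQ (n : ℕ) (S : Finset (Bits n))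
  | com (a b : S)
  | ms (a b : S) (l : Line)
  | basis (W : Basis)
  | mixed (w : PauliString n)
  | tele
  deriving DecidableEq, Fintype

/-- Bob questions. -/
inductive BobQ (n : ℕ) (S : Finset (Bits n))
  | basis (W : Basis)
  | ms (a b : S) (j : Cell)
  | mixed (w : PauliString n)
  deriving DecidableEq, Fintype

/-- The number of bits of Bob's answer. -/
def BobQ.ansLen {n : ℕ} {S : Finset (Bits n)} : BobQ n S → ℕ
  | .basis _ => n
  | .ms _ _ _ => 1
  | .mixed _ => n

/-- The verification predicate, common to the Pauli braiding test and the mixed-versus-pure basis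
test, on Alice's answer `u` (missing bits are read as `0`) and Bob's answer `v`. -/
def accepts {n : ℕ} {S : Finset (Bits n)} :
    AliceQ n S → (y : BobQ n S) → List Bit → Bits y.ansLen → Prop
  | .com a _, .basis .Z, u, v => a.1 ⬝ᵥ (v : Bits n) = u.getD 0 0
  | .com _ b, .basis .X, u, v => b.1 ⬝ᵥ (v : Bits n) = u.getD 1 0
  | .ms a _ l, .basis .Z, u, v => (∑ k : Fin 3, u.getD k 0 = l.parity) ∧
      ∃ k : Fin 3, l.cell k = (0, 1) ∧ a.1 ⬝ᵥ (v : Bits n) = u.getD k 0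
  | .ms _ b l, .basis .X, u, v => (∑ k : Fin 3, u.getD k 0 = l.parity) ∧
      ∃ k : Fin 3, l.cell k = (1, 0) ∧ b.1 ⬝ᵥ (v : Bits n) = u.getD k 0
  | .ms _ _ l, .ms _ _ j, u, v => (∑ k : Fin 3, u.getD k 0 = l.parity) ∧
      ∃ k : Fin 3, l.cell k = j ∧ (v : Bits 1) = fun _ => u.getD k 0
  | .basis _, .basis _, u, v => ∀ i : Fin n, u.getD i 0 = (v : Bits n) i
  | .basis W, .mixed w, u, v => ∀ i : Fin n, w i = W.toPauli → u.getD i 0 = (v : Bits n) i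
  | _, _, _, _ => False

/-- Bob's question in the anticommutation test for the cell `j`: the top centre cell is asked as
`Z`, the centre left cell as `X`. -/
def cellQuestion {n : ℕ} {S : Finset (Bits n)} (a b : S) (j : Cell) : BobQ n S :=
  if j = (0, 1) then .basis .Z else if j = (1, 0) then .basis .X else .ms a b j

/-- Question distribution of the commutation test. -/
def commutationDist {n : ℕ} {S : Finset (Bits n)} (a b : S) : PMF (AliceQ n S × BobQ n S) :=
  (PMF.uniformOfFintype Basis).map fun W => (.com a b, .basis W)

/-- Question distribution of the anticommutation (magic square) test: a uniformly random cell `j`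
for Bob, and for Alice its row or its column, with probability `1/2` each. -/
def anticommutationDist {n : ℕ} {S : Finset (Bits n)} (a b : S) :
    PMF (AliceQ n S × BobQ n S) :=
  (PMF.uniformOfFintype (Cell × Bool)).map fun jo =>
    (.ms a b (if jo.2 then .row jo.1.1 else .col jo.1.2), cellQuestion a b jo.1)

/-- Question distribution of the Pauli braiding test with `a, b` uniform in `S`. -/
def pauliBraidingDist {n : ℕ} (S : Finset (Bits n)) (hS : S.Nonempty) :
    PMF (AliceQ n S × BobQ n S) :=
  haveI : Nonempty S := hS.to_subtype
  (PMF.uniformOfFintype (S × S)).bind fun ab =>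
    if ab.1.1 ⬝ᵥ ab.2.1 = 0 then commutationDist ab.1 ab.2 else anticommutationDist ab.1 ab.2

/-- Question distribution of the mixed-versus-pure basis test. -/
def mixedPureDist {n : ℕ} (S : Finset (Bits n)) (D : PMF (PauliString n)) :
    PMF (AliceQ n S × BobQ n S) :=
  (PMF.uniformOfFintype (Basis × Bool)).bind fun Wb =>
    if Wb.2 then D.map fun w => (.basis Wb.1, .mixed w)
    else PMF.pure (.basis Wb.1, .basis Wb.1)

/-! ### Provers for the compiled tests -/

/-- A prover, for ciphertexts of `ct` bits, on `N` qubits. On a ciphertext `c` it applies `pre`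
to its initial state, measures the qubits `reg` to obtain its first message `α`, and applies `post`,
which depends on `c` and `α`. On a Bob question `y` it measures the qubits `bobReg y` in the
computational basis conjugated by the circuit `bob y`. (One circuit reading an encoding of `y` is
the special case in which `bob y` is that circuit with `y` hardwired.) -/
structure Prover (n : ℕ) (S : Finset (Bits n)) (ct : ℕ) where
  N : ℕ
  msgLen : ℕ
  prep : Circuit 0 N
  pre : Circuit ct N
  reg : Fin msgLen ↪ Fin N
  post : Circuit (ct + msgLen) N
  bob : BobQ n S → Circuit 0 N
  bobReg : (y : BobQ n S) → Fin y.ansLen ↪ Fin N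

namespace Prover

variable {n : ℕ} {S : Finset (Bits n)} {ct : ℕ} (P : Prover n S ct)

/-- The initial pure state `|ψ⟩`. -/
def initial : Bits P.N → ℂ := Circuit.mat P.prep noInput *ᵥ zeroKet P.N

/-- Alice's operator `A^c_α`: a projective measurement followed by a unitary. -/
def alice (c : Bits ct) (α : Bits P.msgLen) : Matrix (Bits P.N) (Bits P.N) ℂ :=
  Circuit.mat P.post (Fin.append c α) * outcomeProj P.reg α * Circuit.mat P.pre c

/-- The unnormalised post-measurement state `|ψ^c_α⟩⟨ψ^c_α|`. -/
def postState (c : Bits ct) (α : Bits P.msgLen) : Matrix (Bits P.N) (Bits P.N) ℂ :=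
  Matrix.vecMulVec (P.alice c α *ᵥ P.initial) (star (P.alice c α *ᵥ P.initial))

/-- Bob's projector `B^y_v`. -/
def bobProj (y : BobQ n S) (v : Bits y.ansLen) : Matrix (Bits P.N) (Bits P.N) ℂ :=
  (Circuit.mat (P.bob y) noInput)ᴴ * outcomeProj (P.bobReg y) v * Circuit.mat (P.bob y) noInput

/-- The mixed-basis projector `M^w_u`. The bits of Bob's answer at positions where `w` is the
identity, which the verifier ignores, are set to `0`. -/
def mixedProj (w : PauliString n) (u : Bits n) : Matrix (Bits P.N) (Bits P.N) ℂ :=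
  ∑ v : Bits n, if (fun i => if w i = .I then 0 else v i) = u then P.bobProj (.mixed w) v else 0

/-- The mixed-basis observable `O^w(a) = ∑_u (-1)^{a·u} M^w_u`. -/
def mixedObs (w : PauliString n) (a : Bits n) : Matrix (Bits P.N) (Bits P.N) ℂ :=
  ∑ u : Bits n, sgn (a ⬝ᵥ u) • P.mixedProj w u

end Prover

/-- The state `ψ^{Enc(q)} = 𝔼_{sk} 𝔼_{c ← Enc_sk(q)} ∑_α |ψ^c_α⟩⟨ψ^c_α|`, where `encode` writes
Alice questions as messages of `m` bits (any encoding is allowed, also a succinct one that is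
injective only on the questions that are actually asked). -/
def encState (E : EncryptionScheme) (lam : ℕ) {n m : ℕ} {S : Finset (Bits n)}
    (encode : AliceQ n S → Bits m) (P : Prover n S (E.ctLen lam m)) (q : AliceQ n S) :
    Matrix (Bits P.N) (Bits P.N) ℂ :=
  expect (E.gen lam) fun sk => expect (E.enc lam sk m (encode q)) fun c =>
    ∑ α : Bits P.msgLen, P.postState c α

open Classical in
/-- The probability that the prover wins the compiled game with question distribution `dist`. -/
def winProb (E : EncryptionScheme) (lam : ℕ) {n m : ℕ} {S : Finset (Bits n)}
    (encode : AliceQ n S → Bits m) (P : Prover n S (E.ctLen lam m))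
    (dist : PMF (AliceQ n S × BobQ n S)) : ℝ :=
  expect dist fun xy => expect (E.gen lam) fun sk => expect (E.enc lam sk m (encode xy.1)) fun c =>
    ∑ α : Bits P.msgLen, ∑ v : Bits xy.2.ansLen,
      if accepts xy.1 xy.2 (E.dec lam sk (List.ofFn α)) v
      then (P.bobProj xy.2 v * P.postState c α).trace.re else 0

/-- A family of provers is efficient if its numbers of qubits and its circuit sizes are bounded
by a polynomial in the security parameter. -/
def EfficientProver {n : ℕ → ℕ} {S : (lam : ℕ) → Finset (Bits (n lam))} {ct : ℕ → ℕ}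
    (P : (lam : ℕ) → Prover (n lam) (S lam) (ct lam)) : Prop :=
  PolyBounded (fun lam => (P lam).N + (P lam).prep.length + (P lam).pre.length +
    (P lam).post.length + Finset.univ.sup fun y => ((P lam).bob y).length)

end

/-! ### Signs -/

/-! Bob's answers define binary observables `obs ⟨y, a⟩ = ∑_v (-1)^{a·v} B^y_v`, which are
self-adjoint unitary involutions; write X(a), Z(a) for those of the two pure bases. For a short
product `W` of such observables, a Hadamard test on one extra qubit, run after Alice's part of the
prover, outputs 1 with probability ‖(1 - W)φ‖²/4 summed over the branches φ. IND-CPA security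
therefore makes the state-dependent norm of a difference of two short words independent of the
encrypted question, up to a negligible δ (`exists_negligible_indist`, `Indist.le`).

This replaces the spatial separation of Alice and Bob. An approximate relation between words
survives multiplication by a unitary on the left, but not on the right, where the state sits. If on
some question the branches are approximate eigenvectors of `o`, with a sign read off Alice's
decrypted answer, then right multiplication by `o` is there nearly multiplication by a sign;
indistinguishability carries the new relation to all other questions (`Rel.concat`). Winning a test
supplies such eigenvectors (`consistent_of_accepts`).

The commutation test and the magic square give Z(a)X(b) ≈ (-1)^{a·b} X(b)Z(a) on average over a, b ∈
S. On the pure-basis question Alice's answer fixes the eigenvalues of all W(a) simultaneously, so a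
pointwise character estimate for the biased set extends the relation to all strings, once in each
basis (`nrm_amplify`, `rel_pauli`).

The isometry is Vφ = ∑_x |x⟩ ⊗ X(x) P_x φ, with P the Z-basis projectors. It pulls a Pauli operator
with X-part d and Z-part c back to `twirl d c`, which equals the average over e of (-1)^{d·e}
Z(e)X(d)Z(e)Z(c) (`exists_isometry`, `twirl_eq`). By the (anti)commutation relation every term is
close to X(d)Z(c), and the mixed-versus-pure test brings X(d)Z(c) close to O^w(a). The resulting
bound is linear in ε; the square root enters only by capping ε at 1. -/

theorem sgn_zero : sgn 0 = 1 := by simp [sgn]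

theorem sgn_one : sgn 1 = -1 := by simp [sgn]

theorem bit_cases (a : Bit) : a = 0 ∨ a = 1 := by
  revert a; decide

theorem sgn_add (a b : Bit) : sgn (a + b) = sgn a * sgn b := by
  have h : (1 : Bit) + 1 = 0 := by decide
  rcases bit_cases a with rfl | rfl <;> rcases bit_cases b with rfl | rfl <;>
    simp [sgn_zero, sgn_one, h]

theorem sgn_mul_self (a : Bit) : sgn a * sgn a = 1 := by
  rcases bit_cases a with rfl | rfl <;> simp [sgn_zero, sgn_one]

theorem norm_sgn (a : Bit) : ‖sgn a‖ = 1 := by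
  rcases bit_cases a with rfl | rfl <;> simp [sgn_zero, sgn_one]

theorem star_sgn (a : Bit) : star (sgn a) = sgn a := by
  rcases bit_cases a with rfl | rfl <;> simp [sgn_zero, sgn_one]

theorem sgn_sum {α : Type} (s : Finset α) (f : α → Bit) :
    sgn (∑ i ∈ s, f i) = ∏ i ∈ s, sgn (f i) := by
  classical
  induction s using Finset.induction_on with
  | empty => simp [sgn_zero]
  | insert a s ha ih => rw [Finset.sum_insert ha, Finset.prod_insert ha, sgn_add, ih]

theorem bit_add_self (a : Bit) : a + a = 0 := CharTwo.add_self_eq_zero a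

theorem norm_sgn_sub_sq (a b : Bit) : ‖sgn a - sgn b‖ ^ 2 = 2 - 2 * (sgn (a + b)).re := by
  have h : (1 : Bit) + 1 = 0 := by decide
  rcases bit_cases a with rfl | rfl <;> rcases bit_cases b with rfl | rfl <;>
    simp only [add_zero, zero_add, h, sgn_zero, sgn_one] <;> norm_num

/-! ### Squared norms of vectors -/

section nsq
variable {ι κ : Type} [Fintype ι] [Fintype κ]

/-- The squared Euclidean norm of a vector. -/
noncomputable def nsq (v : ι → ℂ) : ℝ := ∑ i, ‖v i‖ ^ 2

theorem nsq_nonneg (v : ι → ℂ) : 0 ≤ nsq v := Finset.sum_nonneg fun _ _ => by positivity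

theorem nsq_eq_dotProduct (v : ι → ℂ) : (nsq v : ℂ) = star v ⬝ᵥ v := by
  simp only [nsq, dotProduct, Complex.ofReal_sum, Pi.star_apply]
  refine Finset.sum_congr rfl fun i _ => ?_
  rw [Complex.star_def, ← Complex.normSq_eq_conj_mul_self, Complex.normSq_eq_norm_sq]

theorem nsq_add_add_nsq_sub (u v : ι → ℂ) :
    nsq (u + v) + nsq (u - v) = 2 * nsq u + 2 * nsq v := by
  simp only [nsq, Finset.mul_sum, ← Finset.sum_add_distrib]
  refine Finset.sum_congr rfl fun i _ => ?_
  have := parallelogram_law_with_norm ℝ (u i) (v i)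
  simp only [Pi.add_apply, Pi.sub_apply]
  nlinarith

theorem nsq_add_le (u v : ι → ℂ) : nsq (u + v) ≤ 2 * nsq u + 2 * nsq v := by
  linarith [nsq_add_add_nsq_sub u v, nsq_nonneg (u - v)]

theorem nsq_sub_le (u v : ι → ℂ) : nsq (u - v) ≤ 2 * nsq u + 2 * nsq v := by
  linarith [nsq_add_add_nsq_sub u v, nsq_nonneg (u + v)]

theorem nsq_smul (c : ℂ) (v : ι → ℂ) : nsq (c • v) = ‖c‖ ^ 2 * nsq v := by
  simp [nsq, Finset.mul_sum, mul_pow]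

theorem nsq_sgn_smul (a : Bit) (v : ι → ℂ) : nsq (sgn a • v) = nsq v := by
  simp [nsq_smul, norm_sgn]

theorem nsq_sum_le {β : Type} (s : Finset β) (f : β → ι → ℂ) :
    nsq (∑ j ∈ s, f j) ≤ s.card * ∑ j ∈ s, nsq (f j) := by
  simp only [nsq, Finset.sum_apply]
  rw [Finset.sum_comm, Finset.mul_sum]
  refine Finset.sum_le_sum fun i _ => ?_
  calc ‖∑ j ∈ s, f j i‖ ^ 2 ≤ (∑ j ∈ s, ‖f j i‖) ^ 2 := by gcongr; exact norm_sum_le _ _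
    _ ≤ _ := sq_sum_le_card_mul_sum_sq

theorem nsq_add_three_le (u v w : ι → ℂ) :
    nsq (u + v + w) ≤ 3 * (nsq u + nsq v + nsq w) := by
  have h := nsq_sum_le Finset.univ ![u, v, w]
  simp [Fin.sum_univ_three] at h
  exact h

theorem nsq_mulVec [DecidableEq κ] {A : Matrix ι κ ℂ} (hA : Aᴴ * A = 1) (v : κ → ℂ) :
    nsq (A *ᵥ v) = nsq v := by
  apply Complex.ofReal_injective
  rw [nsq_eq_dotProduct, nsq_eq_dotProduct, Matrix.star_mulVec, ← Matrix.dotProduct_mulVec,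
    Matrix.mulVec_mulVec, hA, Matrix.one_mulVec]

theorem nsq_average_le {β : Type} [Fintype β] [Nonempty β] (f : β → ι → ℂ) :
    nsq ((Fintype.card β : ℂ)⁻¹ • ∑ j, f j) ≤ (Fintype.card β : ℝ)⁻¹ * ∑ j, nsq (f j) := by
  have hc : (0 : ℝ) < Fintype.card β := by exact_mod_cast Fintype.card_pos
  rw [nsq_smul]
  have := nsq_sum_le Finset.univ f
  rw [Finset.card_univ] at this
  calc _ ≤ ‖(Fintype.card β : ℂ)⁻¹‖ ^ 2 * (Fintype.card β * ∑ j, nsq (f j)) := by gcongr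
    _ = _ := by
      rw [norm_inv, Complex.norm_natCast]
      field_simp

/-- A projective measurement. -/
structure IsProjMeas {β : Type} [Fintype β] [DecidableEq β] [DecidableEq ι]
    (M : β → Matrix ι ι ℂ) : Prop where
  herm : ∀ v, (M v)ᴴ = M v
  mul : ∀ v w, M v * M w = if v = w then M v else 0
  sum : ∑ v, M v = 1

namespace IsProjMeas
variable {β : Type} [Fintype β] [DecidableEq β] [DecidableEq ι] {M : β → Matrix ι ι ℂ}

theorem sum_smul_mul_sum_smul (h : IsProjMeas M) (c d : β → ℂ) :
    (∑ v, c v • M v) * (∑ v, d v • M v) = ∑ v, (c v * d v) • M v := by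
  rw [Finset.sum_mul]
  refine Finset.sum_congr rfl fun v _ => ?_
  rw [Finset.mul_sum, Finset.sum_eq_single v]
  · rw [smul_mul_smul_comm, h.mul, if_pos rfl]
  · intro w _ hw
    rw [smul_mul_smul_comm, h.mul, if_neg hw.symm, smul_zero]
  · simp

theorem conjTranspose_sum_smul (h : IsProjMeas M) (c : β → ℂ) :
    (∑ v, c v • M v)ᴴ = ∑ v, star (c v) • M v := by
  simp [Matrix.conjTranspose_sum, Matrix.conjTranspose_smul, h.herm]

theorem dotProduct_mulVec (h : IsProjMeas M) (v : β) (φ : ι → ℂ) :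
    star φ ⬝ᵥ (M v *ᵥ φ) = nsq (M v *ᵥ φ) := by
  rw [nsq_eq_dotProduct, Matrix.star_mulVec, ← Matrix.dotProduct_mulVec, Matrix.mulVec_mulVec,
    h.herm, h.mul, if_pos rfl]

theorem nsq_sum_smul_mulVec (h : IsProjMeas M) (c : β → ℂ) (φ : ι → ℂ) :
    nsq ((∑ v, c v • M v) *ᵥ φ) = ∑ v, ‖c v‖ ^ 2 * nsq (M v *ᵥ φ) := by
  apply Complex.ofReal_injective
  rw [nsq_eq_dotProduct, Matrix.star_mulVec, ← Matrix.dotProduct_mulVec, Matrix.mulVec_mulVec,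
    h.conjTranspose_sum_smul, h.sum_smul_mul_sum_smul, Matrix.sum_mulVec, dotProduct_sum]
  push_cast
  refine Finset.sum_congr rfl fun v _ => ?_
  rw [Matrix.smul_mulVec, dotProduct_smul, h.dotProduct_mulVec, smul_eq_mul, Complex.star_def,
    ← Complex.normSq_eq_conj_mul_self, Complex.normSq_eq_norm_sq]
  push_cast
  rfl

theorem sum_nsq (h : IsProjMeas M) (φ : ι → ℂ) : ∑ v, nsq (M v *ᵥ φ) = nsq φ := by
  have := h.nsq_sum_smul_mulVec (fun _ => 1) φ
  simpa [h.sum] using this.symm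

end IsProjMeas

theorem stateNormSq_sum {β : Type} (s : Finset β) (A : Matrix ι ι ℂ) (ρ : β → Matrix ι ι ℂ) :
    stateNormSq A (∑ j ∈ s, ρ j) = ∑ j ∈ s, stateNormSq A (ρ j) := by
  simp [stateNormSq, Matrix.mul_sum, Matrix.trace_sum]

theorem stateNormSq_smul (A ρ : Matrix ι ι ℂ) (r : ℝ) :
    stateNormSq A (r • ρ) = r * stateNormSq A ρ := by
  simp [stateNormSq, Matrix.trace_smul]

theorem trace_mul_vecMulVec (A : Matrix ι ι ℂ) (u v : ι → ℂ) :
    (A * Matrix.vecMulVec u v).trace = v ⬝ᵥ (A *ᵥ u) := by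
  rw [Matrix.mul_vecMulVec, Matrix.trace_vecMulVec, dotProduct_comm]

theorem stateNormSq_vecMulVec (A : Matrix ι ι ℂ) (φ : ι → ℂ) :
    stateNormSq A (Matrix.vecMulVec φ (star φ)) = nsq (A *ᵥ φ) := by
  rw [stateNormSq, trace_mul_vecMulVec, ← Matrix.mulVec_mulVec, Matrix.dotProduct_mulVec,
    ← Matrix.star_mulVec, ← nsq_eq_dotProduct, Complex.ofReal_re]

end nsq

/-! ### Expectations -/

section expect
variable {α β : Type} [Fintype α] [Fintype β]

theorem sum_toReal_pmf (p : PMF α) : ∑ x, (p x).toReal = 1 := by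
  have h := p.tsum_coe
  rw [tsum_fintype] at h
  rw [← ENNReal.toReal_sum fun x _ => p.apply_ne_top x, h, ENNReal.toReal_one]

theorem expect_eq_sum (p : PMF α) (f : α → ℝ) : expect p f = ∑ x, (p x).toReal * f x := rfl

theorem expect_const (p : PMF α) (c : ℝ) : expect p (fun _ => c) = c := by
  rw [expect_eq_sum, ← Finset.sum_mul, sum_toReal_pmf, one_mul]

theorem expect_mono (p : PMF α) {f g : α → ℝ} (h : ∀ x, f x ≤ g x) : expect p f ≤ expect p g := by
  rw [expect_eq_sum, expect_eq_sum]
  exact Finset.sum_le_sum fun x _ => mul_le_mul_of_nonneg_left (h x) ENNReal.toReal_nonneg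

theorem expect_nonneg (p : PMF α) {f : α → ℝ} (h : ∀ x, 0 ≤ f x) : 0 ≤ expect p f := by
  rw [expect_eq_sum]
  exact Finset.sum_nonneg fun x _ => mul_nonneg ENNReal.toReal_nonneg (h x)

theorem expect_add (p : PMF α) (f g : α → ℝ) :
    expect p (fun x => f x + g x) = expect p f + expect p g := by
  simp [expect_eq_sum, mul_add, Finset.sum_add_distrib]

theorem expect_mul_left (p : PMF α) (c : ℝ) (f : α → ℝ) :
    expect p (fun x => c * f x) = c * expect p f := by
  simp only [expect_eq_sum, Finset.mul_sum]
  exact Finset.sum_congr rfl fun _ _ => by ring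

theorem expect_bind (p : PMF α) (k : α → PMF β) (f : β → ℝ) :
    expect (p.bind k) f = expect p fun x => expect (k x) f := by
  simp only [expect_eq_sum, PMF.bind_apply, tsum_fintype, Finset.mul_sum]
  rw [Finset.sum_comm]
  refine Finset.sum_congr rfl fun y _ => ?_
  rw [ENNReal.toReal_sum fun x _ => ENNReal.mul_ne_top (p.apply_ne_top x) ((k x).apply_ne_top y),
    Finset.sum_mul]
  exact Finset.sum_congr rfl fun x _ => by rw [ENNReal.toReal_mul, mul_assoc]

theorem expect_pure (x : α) (f : α → ℝ) : expect (PMF.pure x) f = f x := by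
  classical
  rw [expect_eq_sum, Finset.sum_eq_single x]
  · simp
  · intro y _ hy
    simp [PMF.pure_apply, hy]
  · simp

theorem expect_map (p : PMF α) (g : α → β) (f : β → ℝ) :
    expect (p.map g) f = expect p fun x => f (g x) := by
  rw [← PMF.bind_pure_comp, expect_bind]
  simp [expect_pure]

theorem expect_uniform [Nonempty α] (f : α → ℝ) :
    expect (PMF.uniformOfFintype α) f = (Fintype.card α : ℝ)⁻¹ * ∑ x, f x := by
  simp [expect_eq_sum, Finset.mul_sum]

theorem le_card_mul_expect_uniform [Nonempty α] (f : α → ℝ) (hf : ∀ x, 0 ≤ f x) (x : α) :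
    f x ≤ Fintype.card α * expect (PMF.uniformOfFintype α) f := by
  have hc : (0 : ℝ) < Fintype.card α := by exact_mod_cast Fintype.card_pos
  rw [expect_uniform, mul_inv_cancel_left₀ hc.ne']
  exact Finset.single_le_sum (fun y _ => hf y) (Finset.mem_univ x)

end expect

/-! ### Circuits are unitary -/

/-- The splitting of `N` qubits into two of them and the others. -/
def splitTwo {N : ℕ} (i j : Fin N) (hij : i ≠ j) :
    Bits N ≃ (Bit × Bit) × ({k : Fin N // k ≠ i ∧ k ≠ j} → Bit) where
  toFun x := ((x i, x j), fun k => x k)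
  invFun p k := if hi : k = i then p.1.1 else if hj : k = j then p.1.2 else p.2 ⟨k, hi, hj⟩
  left_inv x := by
    funext k
    by_cases hi : k = i
    · simp [hi]
    · by_cases hj : k = j
      · subst hj; simp [hi]
      · simp [hi, hj]
  right_inv p := by
    ext k
    · simp
    · simp [hij.symm]
    · simp [k.2.1, k.2.2]

/-- After regrouping the qubits a gate is U ⊗ 1, which reduces its unitarity to that of U. -/
theorem conjTranspose_mul_self_submatrix_kronecker {ι κ τ : Type} [Fintype ι] [DecidableEq ι]
    [Fintype κ] [DecidableEq κ] [Fintype τ] [DecidableEq τ] (e : ι ≃ κ × τ)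
    (U : Matrix.unitaryGroup κ ℂ) :
    ((U.1 ⊗ₖ (1 : Matrix τ τ ℂ)).submatrix e e)ᴴ * (U.1 ⊗ₖ (1 : Matrix τ τ ℂ)).submatrix e e
      = 1 := by
  have h : (U.1)ᴴ * U.1 = 1 := Matrix.UnitaryGroup.star_mul_self U
  rw [Matrix.conjTranspose_submatrix, Matrix.submatrix_mul_equiv, Matrix.conjTranspose_kronecker,
    ← Matrix.mul_kronecker_mul, h, Matrix.conjTranspose_one, one_mul, Matrix.one_kronecker_one,
    Matrix.submatrix_one_equiv]

theorem Gate.mat_one_eq {N : ℕ} (i : Fin N) (U : Matrix.unitaryGroup Bit ℂ) :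
    (Gate.one i U).mat =
      (U.1 ⊗ₖ (1 : Matrix ({k // k ≠ i} → Bit) ({k // k ≠ i} → Bit) ℂ)).submatrix
        (Equiv.funSplitAt i Bit) (Equiv.funSplitAt i Bit) := by
  ext x y
  simp only [Gate.mat, Matrix.of_apply, Matrix.submatrix_apply, Equiv.funSplitAt_apply,
    Matrix.kroneckerMap_apply, Matrix.one_apply, funext_iff, Subtype.forall, mul_ite, mul_one,
    mul_zero]

theorem Gate.mat_two_eq {N : ℕ} (i j : Fin N) (hij : i ≠ j)
    (U : Matrix.unitaryGroup (Bit × Bit) ℂ) :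
    (Gate.two i j hij U).mat =
      (U.1 ⊗ₖ (1 : Matrix ({k : Fin N // k ≠ i ∧ k ≠ j} → Bit)
        ({k : Fin N // k ≠ i ∧ k ≠ j} → Bit) ℂ)).submatrix
        (splitTwo i j hij) (splitTwo i j hij) := by
  ext x y
  simp only [Gate.mat, Matrix.of_apply, Matrix.submatrix_apply, splitTwo, Equiv.coe_fn_mk,
    Matrix.kroneckerMap_apply, Matrix.one_apply, funext_iff, Subtype.forall, mul_ite, mul_one,
    mul_zero, and_imp]

theorem Gate.conjTranspose_mul_self {N : ℕ} (g : Gate N) : g.matᴴ * g.mat = 1 := by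
  cases g with
  | one i U => rw [Gate.mat_one_eq, conjTranspose_mul_self_submatrix_kronecker]
  | two i j h U => rw [Gate.mat_two_eq, conjTranspose_mul_self_submatrix_kronecker]

theorem Step.conjTranspose_mul_self {k N : ℕ} (s : Step k N) (x : Bits k) :
    (s.mat x)ᴴ * s.mat x = 1 := by
  rcases s with ⟨_ | i, g⟩
  · exact g.conjTranspose_mul_self
  · by_cases h : x i = 1
    · simpa [Step.mat, h] using g.conjTranspose_mul_self
    · simp [Step.mat, h]

theorem Circuit.conjTranspose_mul_self {k N : ℕ} (C : Circuit k N) (x : Bits k) :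
    (Circuit.mat C x)ᴴ * Circuit.mat C x = 1 := by
  induction C with
  | nil => simp [Circuit.mat]
  | cons s C ih =>
    rw [Circuit.mat, Matrix.conjTranspose_mul, Matrix.mul_assoc, ← Matrix.mul_assoc _ _ (s.mat x),
      ih, Matrix.one_mul, s.conjTranspose_mul_self]

theorem Circuit.mul_conjTranspose_self {k N : ℕ} (C : Circuit k N) (x : Bits k) :
    Circuit.mat C x * (Circuit.mat C x)ᴴ = 1 :=
  mul_eq_one_comm.mp (C.conjTranspose_mul_self x)

theorem Circuit.nsq_mat_mulVec {k N : ℕ} (C : Circuit k N) (x : Bits k) (φ : Bits N → ℂ) :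
    nsq (Circuit.mat C x *ᵥ φ) = nsq φ := nsq_mulVec (C.conjTranspose_mul_self x) φ

/-! ### Measurements -/

theorem isProjMeas_outcomeProj {r N : ℕ} (reg : Fin r ↪ Fin N) : IsProjMeas (outcomeProj reg) where
  herm v := by
    rw [outcomeProj, Matrix.diagonal_conjTranspose]
    congr 1
    funext x
    simp only [Pi.star_apply]
    split_ifs <;> simp
  mul v w := by
    rw [outcomeProj, outcomeProj, Matrix.diagonal_mul_diagonal]
    split_ifs with h
    · subst h
      congr 1
      funext x
      split_ifs <;> simp
    · rw [← Matrix.diagonal_zero]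
      congr 1
      funext x
      by_cases h1 : ∀ i, x (reg i) = v i
      · rw [if_pos h1, if_neg fun h2 => h (funext fun i => (h1 i).symm.trans (h2 i)), mul_zero]
      · rw [if_neg h1, zero_mul]
  sum := by
    rw [← Matrix.diagonal_one]
    ext x y
    simp only [outcomeProj, Matrix.sum_apply, Matrix.diagonal_apply]
    split_ifs with hxy
    · rw [Finset.sum_eq_single fun i => x (reg i)]
      · simp
      · intro v _ hv
        rw [if_neg]
        exact fun h => hv (funext fun i => (h i).symm)
      · simp
    · simp

theorem nsq_zeroKet (N : ℕ) : nsq (zeroKet N) = 1 := by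
  rw [nsq, Finset.sum_eq_single 0]
  · simp [zeroKet]
  · intro x _ hx
    simp [zeroKet, hx]
  · simp

namespace Prover
variable {n : ℕ} {S : Finset (Bits n)} {ct : ℕ} (P : Prover n S ct)

theorem isProjMeas_bobProj (y : BobQ n S) : IsProjMeas (P.bobProj y) := by
  have h := isProjMeas_outcomeProj (P.bobReg y)
  have hU := (P.bob y).conjTranspose_mul_self noInput
  have hU' := (P.bob y).mul_conjTranspose_self noInput
  refine ⟨fun v => ?_, fun v w => ?_, ?_⟩
  · simp [bobProj, h.herm, Matrix.mul_assoc]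
  · simp only [bobProj]
    set U := Circuit.mat (P.bob y) noInput
    calc Uᴴ * outcomeProj (P.bobReg y) v * U * (Uᴴ * outcomeProj (P.bobReg y) w * U)
        = Uᴴ * (outcomeProj (P.bobReg y) v * (U * Uᴴ) * outcomeProj (P.bobReg y) w) * U := by
          simp only [Matrix.mul_assoc]
      _ = _ := by
          rw [hU', Matrix.mul_one, h.mul]
          split_ifs <;> simp
  · simp only [bobProj]
    rw [← Finset.sum_mul, ← Finset.mul_sum, h.sum, Matrix.mul_one, hU]

theorem nsq_initial : nsq P.initial = 1 := by
  rw [initial, Circuit.nsq_mat_mulVec, nsq_zeroKet]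

theorem sum_nsq_alice (c : Bits ct) : ∑ α, nsq (P.alice c α *ᵥ P.initial) = 1 := by
  simp only [alice, ← Matrix.mulVec_mulVec, Circuit.nsq_mat_mulVec]
  rw [(isProjMeas_outcomeProj P.reg).sum_nsq, Circuit.nsq_mat_mulVec, nsq_initial]

/-! ### Bob's observables and their products -/

/-- Bob's observable `∑_v (-1)^{a·v} B^y_v`. -/
noncomputable def obs (o : Σ y : BobQ n S, Bits y.ansLen) : Matrix (Bits P.N) (Bits P.N) ℂ :=
  ∑ v, sgn (o.2 ⬝ᵥ v) • P.bobProj o.1 v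

theorem obs_mul_obs (y : BobQ n S) (a b : Bits y.ansLen) :
    P.obs ⟨y, a⟩ * P.obs ⟨y, b⟩ = P.obs ⟨y, a + b⟩ := by
  simp only [obs]
  rw [(P.isProjMeas_bobProj y).sum_smul_mul_sum_smul]
  simp only [add_dotProduct, sgn_add]

theorem obs_zero (y : BobQ n S) : P.obs ⟨y, 0⟩ = 1 := by
  simp [obs, sgn_zero, (P.isProjMeas_bobProj y).sum]

theorem obs_mul_self (o : Σ y : BobQ n S, Bits y.ansLen) : P.obs o * P.obs o = 1 := by
  rcases o with ⟨y, a⟩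
  rw [obs_mul_obs, show a + a = 0 from funext fun i => bit_add_self (a i), obs_zero]

theorem conjTranspose_obs (o : Σ y : BobQ n S, Bits y.ansLen) : (P.obs o)ᴴ = P.obs o := by
  rw [obs, (P.isProjMeas_bobProj o.1).conjTranspose_sum_smul]
  simp only [star_sgn]

theorem nsq_obs_mulVec (o : Σ y : BobQ n S, Bits y.ansLen) (φ : Bits P.N → ℂ) :
    nsq (P.obs o *ᵥ φ) = nsq φ :=
  nsq_mulVec (by rw [conjTranspose_obs, obs_mul_self]) φ

/-- The coefficient is 0 on outcomes whose parity is t and 4 on the others. It is also affine in a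
character of v, which is what the amplification from S exploits. -/
theorem nsq_obs_mulVec_sub (o : Σ y : BobQ n S, Bits y.ansLen) (t : Bit) (φ : Bits P.N → ℂ) :
    nsq (P.obs o *ᵥ φ - sgn t • φ) =
      ∑ v, (2 - 2 * (sgn (o.2 ⬝ᵥ v + t)).re) * nsq (P.bobProj o.1 v *ᵥ φ) := by
  have hM := P.isProjMeas_bobProj o.1
  have h : P.obs o *ᵥ φ - sgn t • φ =
      (∑ v, (sgn (o.2 ⬝ᵥ v) - sgn t) • P.bobProj o.1 v) *ᵥ φ := by
    simp only [sub_smul, Finset.sum_sub_distrib, ← Finset.smul_sum, hM.sum]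
    rw [Matrix.sub_mulVec, Matrix.smul_mulVec, Matrix.one_mulVec, obs]
  rw [h, hM.nsq_sum_smul_mulVec]
  simp only [norm_sgn_sub_sq]

/-- Only the diagonal sign in the middle has to be controlled in order to apply the observable
conditionally. -/
theorem obs_eq (o : Σ y : BobQ n S, Bits y.ansLen) :
    P.obs o = (Circuit.mat (P.bob o.1) noInput)ᴴ *
      Matrix.diagonal (fun x => sgn (o.2 ⬝ᵥ fun i => x (P.bobReg o.1 i))) *
        Circuit.mat (P.bob o.1) noInput := by
  have h : ∑ v, sgn (o.2 ⬝ᵥ v) • outcomeProj (P.bobReg o.1) v =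
      Matrix.diagonal (fun x => sgn (o.2 ⬝ᵥ fun i => x (P.bobReg o.1 i))) := by
    ext x y
    simp only [outcomeProj, Matrix.sum_apply, Matrix.smul_apply, Matrix.diagonal_apply, smul_eq_mul]
    split_ifs with hxy
    · rw [Finset.sum_eq_single fun i => x (P.bobReg o.1 i)]
      · simp
      · intro v _ hv
        rw [if_neg, mul_zero]
        exact fun h => hv (funext fun i => (h i).symm)
      · simp
    · simp
  rw [← h, Finset.mul_sum, Finset.sum_mul]
  simp [obs, bobProj]

/-- The product of the observables in a list. -/
noncomputable def word (L : List (Σ y : BobQ n S, Bits y.ansLen)) :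
    Matrix (Bits P.N) (Bits P.N) ℂ := (L.map P.obs).prod

theorem word_nil : P.word [] = 1 := rfl

theorem word_cons (o : Σ y : BobQ n S, Bits y.ansLen)
    (L : List (Σ y : BobQ n S, Bits y.ansLen)) :
    P.word (o :: L) = P.obs o * P.word L := by simp [word]

theorem word_append (L L' : List (Σ y : BobQ n S, Bits y.ansLen)) :
    P.word (L ++ L') = P.word L * P.word L' := by simp [word]

/-- Each letter is an involution, so the reversed word is the inverse; inverses of words are again
words. -/
theorem word_mul_word_reverse (L : List (Σ y : BobQ n S, Bits y.ansLen)) :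
    P.word L * P.word L.reverse = 1 := by
  induction L with
  | nil => simp [word_nil]
  | cons o L ih =>
    rw [List.reverse_cons, word_append, word_cons, word_cons, word_nil, Matrix.mul_one,
      Matrix.mul_assoc, ← Matrix.mul_assoc _ _ (P.obs o), ih, Matrix.one_mul, obs_mul_self]

theorem nsq_word_mulVec (L : List (Σ y : BobQ n S, Bits y.ansLen)) (φ : Bits P.N → ℂ) :
    nsq (P.word L *ᵥ φ) = nsq φ := by
  induction L with
  | nil => rw [word_nil, Matrix.one_mulVec]
  | cons o L ih => rw [word_cons, ← Matrix.mulVec_mulVec, nsq_obs_mulVec, ih]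

end Prover

/-! ### Circuits with an additional qubit -/

theorem Circuit.mat_append {k N : ℕ} (C C' : Circuit k N) (x : Bits k) :
    Circuit.mat (C ++ C') x = Circuit.mat C' x * Circuit.mat C x := by
  induction C with
  | nil => simp [Circuit.mat]
  | cons s C ih =>
    have h : (s :: C) ++ C' = s :: (C ++ C') := rfl
    rw [h, Circuit.mat, ih, Circuit.mat, Matrix.mul_assoc]

/-- The inverse of a gate. -/
noncomputable def Gate.inv {N : ℕ} : Gate N → Gate N
  | .one i U => .one i U⁻¹
  | .two i j hij U => .two i j hij U⁻¹

theorem Gate.mat_inv {N : ℕ} (g : Gate N) : g.inv.mat = g.matᴴ := by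
  cases g with
  | one i U =>
    ext x y
    simp only [Gate.inv, Gate.mat, Matrix.of_apply, Matrix.conjTranspose_apply,
      Matrix.UnitaryGroup.inv_val, Matrix.star_apply, eq_comm]
    split_ifs <;> simp
  | two i j h U =>
    ext x y
    simp only [Gate.inv, Gate.mat, Matrix.of_apply, Matrix.conjTranspose_apply,
      Matrix.UnitaryGroup.inv_val, Matrix.star_apply, eq_comm]
    split_ifs <;> simp

/-- The inverse of a step. -/
noncomputable def Step.inv {k N : ℕ} (s : Step k N) : Step k N := ⟨s.control, s.gate.inv⟩

theorem Step.mat_inv {k N : ℕ} (s : Step k N) (x : Bits k) : s.inv.mat x = (s.mat x)ᴴ := by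
  rcases s with ⟨_ | i, g⟩
  · simp [Step.inv, Step.mat, g.mat_inv]
  · by_cases h : x i = 1 <;> simp [Step.inv, Step.mat, g.mat_inv, h]

/-- The inverse of a circuit. -/
noncomputable def Circuit.inv {k N : ℕ} (C : Circuit k N) : Circuit k N :=
  (C.map Step.inv).reverse

theorem Circuit.mat_inv {k N : ℕ} (C : Circuit k N) (x : Bits k) :
    Circuit.mat C.inv x = (Circuit.mat C x)ᴴ := by
  induction C with
  | nil => simp [Circuit.inv, Circuit.mat]
  | cons s C ih =>
    have h : Circuit.inv (s :: C) = Circuit.inv C ++ [s.inv] := by simp [Circuit.inv]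
    rw [h, Circuit.mat_append, ih]
    simp [Circuit.mat, s.mat_inv]

/-- The matrix `1 ⊗ M` on `N + 1` qubits. -/
def liftMat {N : ℕ} (M : Matrix (Bits N) (Bits N) ℂ) : Matrix (Bits (N + 1)) (Bits (N + 1)) ℂ :=
  Matrix.of fun x y => if x 0 = y 0 then M (Fin.tail x) (Fin.tail y) else 0

/-- The vector `|0⟩ ⊗ φ₀ + |1⟩ ⊗ φ₁` on `N + 1` qubits. -/
def joinVec {N : ℕ} (φ₀ φ₁ : Bits N → ℂ) : Bits (N + 1) → ℂ := fun z =>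
  if z 0 = 0 then φ₀ (Fin.tail z) else φ₁ (Fin.tail z)

theorem sum_bits_succ {N : ℕ} {M : Type} [AddCommMonoid M] (f : Bits (N + 1) → M) :
    ∑ z, f z = ∑ z : Bits N, f (Fin.cons 0 z) + ∑ z : Bits N, f (Fin.cons 1 z) := by
  rw [← Equiv.sum_comp (Fin.consEquiv fun _ => Bit) f, Fintype.sum_prod_type]
  exact Fin.sum_univ_two _

theorem liftMat_mulVec_joinVec {N : ℕ} (M : Matrix (Bits N) (Bits N) ℂ) (φ₀ φ₁ : Bits N → ℂ) :
    liftMat M *ᵥ joinVec φ₀ φ₁ = joinVec (M *ᵥ φ₀) (M *ᵥ φ₁) := by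
  funext z
  simp only [Matrix.mulVec, dotProduct, sum_bits_succ, liftMat, joinVec, Matrix.of_apply,
    Fin.cons_zero, Fin.tail_cons]
  rcases bit_cases (z 0) with h | h <;> simp [h]

/-- A gate on the last `N` of `N + 1` qubits. -/
def Gate.lift {N : ℕ} : Gate N → Gate (N + 1)
  | .one i U => .one i.succ U
  | .two i j hij U => .two i.succ j.succ (fun h => hij (Fin.succ_injective _ h)) U

theorem Gate.mat_lift {N : ℕ} (g : Gate N) : g.lift.mat = liftMat g.mat := by
  cases g with
  | one i U =>
    ext x y
    simp only [Gate.lift, Gate.mat, liftMat, Matrix.of_apply, Fin.forall_fin_succ, Fin.tail]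
    by_cases h : x 0 = y 0
    · simp [h, (Fin.succ_ne_zero i).symm]
      congr
    · simp [h, (Fin.succ_ne_zero i).symm]
  | two i j hij U =>
    ext x y
    simp only [Gate.lift, Gate.mat, liftMat, Matrix.of_apply, Fin.forall_fin_succ, Fin.tail]
    by_cases h : x 0 = y 0
    · simp [h, (Fin.succ_ne_zero i).symm, (Fin.succ_ne_zero j).symm]
      congr
    · simp [h, (Fin.succ_ne_zero i).symm, (Fin.succ_ne_zero j).symm]

/-- A circuit on the last `N` of `N + 1` qubits, its controls renamed by `f`. -/
def Circuit.lift {k k' N : ℕ} (f : Fin k → Fin k') (C : Circuit k N) : Circuit k' (N + 1) :=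
  C.map fun s => ⟨s.control.map f, s.gate.lift⟩

theorem Circuit.length_lift {k k' N : ℕ} (f : Fin k → Fin k') (C : Circuit k N) :
    (C.lift f).length = C.length := List.length_map _

theorem Circuit.mat_lift_mulVec {k k' N : ℕ} (f : Fin k → Fin k') (C : Circuit k N) (x : Bits k')
    (φ₀ φ₁ : Bits N → ℂ) :
    Circuit.mat (C.lift f) x *ᵥ joinVec φ₀ φ₁ =
      joinVec (Circuit.mat C (x ∘ f) *ᵥ φ₀) (Circuit.mat C (x ∘ f) *ᵥ φ₁) := by
  induction C generalizing φ₀ φ₁ with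
  | nil => simp [Circuit.lift, Circuit.mat]
  | cons s C ih =>
    have h : Circuit.lift f (s :: C) = ⟨s.control.map f, s.gate.lift⟩ :: Circuit.lift f C := rfl
    have hs : Step.mat ⟨s.control.map f, s.gate.lift⟩ x *ᵥ joinVec φ₀ φ₁ =
        joinVec (s.mat (x ∘ f) *ᵥ φ₀) (s.mat (x ∘ f) *ᵥ φ₁) := by
      rcases s with ⟨_ | i, g⟩
      · simp only [Step.mat, Option.map_none, g.mat_lift, liftMat_mulVec_joinVec]
      · simp only [Step.mat, Option.map_some, g.mat_lift, Function.comp_apply]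
        split_ifs
        · rw [liftMat_mulVec_joinVec]
        · simp
    rw [h, Circuit.mat, ← Matrix.mulVec_mulVec, hs, ih, Circuit.mat, Matrix.mulVec_mulVec,
      Matrix.mulVec_mulVec]

theorem outcomeProj_succ_mulVec {r N : ℕ} (reg : Fin r ↪ Fin N) (v : Bits r)
    (φ₀ φ₁ : Bits N → ℂ) :
    outcomeProj (reg.trans (Fin.succEmb N)) v *ᵥ joinVec φ₀ φ₁ =
      joinVec (outcomeProj reg v *ᵥ φ₀) (outcomeProj reg v *ᵥ φ₁) := by
  funext z
  simp only [outcomeProj, Matrix.mulVec_diagonal, joinVec, Function.Embedding.trans_apply,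
    Fin.coe_succEmb, Fin.tail]
  by_cases h : z 0 = 0 <;> by_cases hv : ∀ i, z (reg i).succ = v i <;> simp [h, hv]

theorem zeroKet_succ (N : ℕ) : zeroKet (N + 1) = joinVec (zeroKet N) 0 := by
  funext z
  have : z = 0 ↔ z 0 = 0 ∧ Fin.tail z = 0 := by
    simp [funext_iff, Fin.forall_fin_succ, Fin.tail]
  simp only [zeroKet, joinVec, Pi.single_apply, this]
  by_cases h : z 0 = 0 <;> simp [h]

/-! ### Gates of the Hadamard test -/

/-- The Hadamard gate. -/
noncomputable def hadamard : Matrix.unitaryGroup Bit ℂ :=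
  ⟨Matrix.of fun a b => ((√2 : ℝ) : ℂ)⁻¹ * sgn (a * b), by
    have h2 : ((√2 : ℝ) : ℂ) * ((√2 : ℝ) : ℂ) = 2 := by
      rw [← Complex.ofReal_mul, Real.mul_self_sqrt (by norm_num)]; norm_num
    have h0 : ((√2 : ℝ) : ℂ) ≠ 0 := by
      intro h; rw [h] at h2; norm_num at h2
    have hc : (starRingEnd ℂ) ((√2 : ℝ) : ℂ) = ((√2 : ℝ) : ℂ) := Complex.conj_ofReal _
    have hs (f : Bit → ℂ) : ∑ z, f z = f 0 + f 1 := Fin.sum_univ_two f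
    rw [Matrix.mem_unitaryGroup_iff]
    ext a b
    rw [Matrix.mul_apply, hs]
    have h01 : (0 : Bit) ≠ 1 := by decide
    have h10 : (1 : Bit) ≠ 0 := by decide
    have h4 : ((√2 : ℝ) : ℂ)⁻¹ * ((√2 : ℝ) : ℂ)⁻¹ = 1 / 2 := by
      rw [← mul_inv, h2]; norm_num
    rcases bit_cases a with rfl | rfl <;> rcases bit_cases b with rfl | rfl <;>
      simp [sgn_zero, sgn_one, h01, h10, h4, hc] <;> norm_num⟩

theorem hadamard_mulVec_joinVec {N : ℕ} (φ₀ φ₁ : Bits N → ℂ) :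
    (Gate.one (0 : Fin (N + 1)) hadamard).mat *ᵥ joinVec φ₀ φ₁ =
      joinVec (((√2 : ℝ) : ℂ)⁻¹ • (φ₀ + φ₁)) (((√2 : ℝ) : ℂ)⁻¹ • (φ₀ - φ₁)) := by
  funext z
  have h10 : (1 : Bit) ≠ 0 := by decide
  simp only [Matrix.mulVec, dotProduct, sum_bits_succ, Gate.mat, joinVec, Matrix.of_apply,
    Fin.forall_fin_succ, Fin.cons_zero, Fin.tail_cons, Fin.cons_succ, ne_eq, not_true_eq_false,
    false_implies, Fin.succ_ne_zero, not_false_eq_true, forall_const, true_and]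
  have h (y : Bits N) : (∀ i : Fin N, z i.succ = y i) ↔ Fin.tail z = y := by
    simp [funext_iff, Fin.tail]
  simp only [h, hadamard, Matrix.of_apply, ite_mul, zero_mul, Finset.sum_ite_eq, Finset.mem_univ,
    if_true, h10, if_false, mul_zero, mul_one]
  rcases bit_cases (z 0) with hz | hz <;> simp [hz, sgn_zero, sgn_one] <;> ring

/-- The controlled phase gate, or the identity if `b = 0`. -/
noncomputable def phaseUnitary (b : Bit) : Matrix.unitaryGroup (Bit × Bit) ℂ :=
  ⟨Matrix.diagonal fun p => sgn (p.1 * (b * p.2)), by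
    rw [Matrix.mem_unitaryGroup_iff, Matrix.star_eq_conjTranspose,
      Matrix.diagonal_conjTranspose, Matrix.diagonal_mul_diagonal, ← Matrix.diagonal_one]
    congr 1
    funext p
    rw [Pi.star_apply, star_sgn, sgn_mul_self]⟩

theorem phaseGate_mat {N : ℕ} (b : Bit) (j : Fin N) :
    (Gate.two (0 : Fin (N + 1)) j.succ (Fin.succ_ne_zero j).symm (phaseUnitary b)).mat =
      Matrix.diagonal fun z => sgn (z 0 * (b * z j.succ)) := by
  ext x y
  simp only [Gate.mat, phaseUnitary, Matrix.of_apply, Matrix.diagonal_apply, Prod.mk.injEq]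
  by_cases h : x = y
  · simp [h]
  · rw [if_neg h]
    split_ifs with h1 h2
    · exact absurd (funext fun k => by
        by_cases hk : k = 0
        · exact hk ▸ h2.1
        · by_cases hj : k = j.succ
          · exact hj ▸ h2.2
          · exact h1 k hk hj) h
    · rfl
    · rfl

/-- Phase gates controlled by the first qubit. -/
noncomputable def phaseCircuit {k r N : ℕ} (reg : Fin r ↪ Fin N) (a : Bits r) :
    Circuit k (N + 1) :=
  (List.finRange r).map fun i =>
    ⟨none, .two 0 (reg i).succ (Fin.succ_ne_zero _).symm (phaseUnitary (a i))⟩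

theorem phaseCircuit_mulVec {k r N : ℕ} (reg : Fin r ↪ Fin N) (a : Bits r) (x : Bits k)
    (φ₀ φ₁ : Bits N → ℂ) :
    Circuit.mat (phaseCircuit reg a) x *ᵥ joinVec φ₀ φ₁ =
      joinVec φ₀ (Matrix.diagonal (fun z => sgn (a ⬝ᵥ fun i => z (reg i))) *ᵥ φ₁) := by
  have key (l : List (Fin r)) : Circuit.mat (l.map fun i =>
      (⟨none, .two 0 (reg i).succ (Fin.succ_ne_zero _).symm (phaseUnitary (a i))⟩ :
        Step k (N + 1))) x =
      Matrix.diagonal fun z => sgn (z 0 * (l.map fun i => a i * z (reg i).succ).sum) := by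
    induction l with
    | nil => simp [Circuit.mat, sgn_zero]
    | cons i l ih =>
      rw [List.map_cons, Circuit.mat, ih]
      simp only [Step.mat]
      rw [phaseGate_mat, Matrix.diagonal_mul_diagonal]
      congr 1
      funext z
      rw [List.map_cons, List.sum_cons, mul_add, sgn_add, mul_comm]
  rw [phaseCircuit, key]
  funext z
  have h : ((List.finRange r).map fun i => a i * z (reg i).succ).sum =
      a ⬝ᵥ fun i => Fin.tail z (reg i) := by
    rw [dotProduct, ← List.sum_ofFn, List.ofFn_eq_map]
    rfl
  rw [Matrix.mulVec_diagonal, h]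
  rcases bit_cases (z 0) with hz | hz
  · simp [joinVec, hz, sgn_zero]
  · simp [joinVec, hz, Matrix.mulVec_diagonal]

/-! ### The Hadamard test -/

namespace Prover
variable {n : ℕ} {S : Finset (Bits n)} {ct : ℕ} (P : Prover n S ct)

/-- A circuit that applies `P.obs o`, controlled by the first qubit. -/
noncomputable def obsCircuit (k : ℕ) (o : Σ y : BobQ n S, Bits y.ansLen) : Circuit k (P.N + 1) :=
  (P.bob o.1).lift Fin.elim0 ++ (phaseCircuit (P.bobReg o.1) o.2 ++
    (P.bob o.1).inv.lift Fin.elim0)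

/-- Bob's circuit and its inverse act on both halves, but on the |0⟩ half no phase stands between
them and they cancel. -/
theorem obsCircuit_mulVec {k : ℕ} (o : Σ y : BobQ n S, Bits y.ansLen) (x : Bits k)
    (φ₀ φ₁ : Bits P.N → ℂ) :
    Circuit.mat (P.obsCircuit k o) x *ᵥ joinVec φ₀ φ₁ = joinVec φ₀ (P.obs o *ᵥ φ₁) := by
  have hx : x ∘ Fin.elim0 = noInput := Subsingleton.elim _ _
  rw [obsCircuit, Circuit.mat_append, Circuit.mat_append, ← Matrix.mulVec_mulVec,
    ← Matrix.mulVec_mulVec, Circuit.mat_lift_mulVec, phaseCircuit_mulVec, Circuit.mat_lift_mulVec,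
    hx, Circuit.mat_inv, obs_eq]
  simp only [Matrix.mulVec_mulVec, Circuit.conjTranspose_mul_self, Matrix.one_mulVec,
    Matrix.mul_assoc]

theorem ansLen_le (y : BobQ n S) : y.ansLen ≤ P.N := by
  simpa using Fintype.card_le_of_embedding (P.bobReg y)

theorem length_obsCircuit (k : ℕ) (o : Σ y : BobQ n S, Bits y.ansLen) :
    (P.obsCircuit k o).length ≤ 2 * (P.bob o.1).length + P.N := by
  have := P.ansLen_le o.1
  simp only [obsCircuit, List.length_append, Circuit.length_lift, phaseCircuit, List.length_map,
    List.length_finRange, Circuit.inv, List.length_reverse]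
  omega

/-- A circuit that applies `P.word L`, controlled by the first qubit. -/
noncomputable def wordCircuit (k : ℕ) :
    List (Σ y : BobQ n S, Bits y.ansLen) → Circuit k (P.N + 1)
  | [] => []
  | o :: L => wordCircuit k L ++ P.obsCircuit k o

theorem wordCircuit_mulVec {k : ℕ} (L : List (Σ y : BobQ n S, Bits y.ansLen)) (x : Bits k)
    (φ₀ φ₁ : Bits P.N → ℂ) :
    Circuit.mat (P.wordCircuit k L) x *ᵥ joinVec φ₀ φ₁ = joinVec φ₀ (P.word L *ᵥ φ₁) := by
  induction L with
  | nil => simp [wordCircuit, Circuit.mat, word_nil]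
  | cons o L ih =>
    rw [wordCircuit, Circuit.mat_append, ← Matrix.mulVec_mulVec, ih, obsCircuit_mulVec, word_cons,
      Matrix.mulVec_mulVec]

theorem length_wordCircuit {k B : ℕ} (hB : ∀ y, (P.bob y).length ≤ B)
    (L : List (Σ y : BobQ n S, Bits y.ansLen)) :
    (P.wordCircuit k L).length ≤ L.length * (2 * B + P.N) := by
  induction L with
  | nil => simp [wordCircuit]
  | cons o L ih =>
    have := P.length_obsCircuit k o
    have := hB o.1
    rw [wordCircuit, List.length_append, List.length_cons]
    linarith

/-- The adversary that runs Alice's part of the prover on its challenge and then performs a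
Hadamard test of `P.word L`. -/
noncomputable def tester {ctl : ℕ → ℕ} {n m : ℕ} {S : Finset (Bits n)} (P : Prover n S (ctl m))
    (L : List (Σ y : BobQ n S, Bits y.ansLen)) : Adversary ctl (P.N + 1) (ctl m) :=
  .measure (P.prep.lift Fin.elim0 ++ P.pre.lift id) (P.reg.trans (Fin.succEmb P.N))
    (.output (P.post.lift id ++ (⟨none, .one 0 hadamard⟩ :: (P.wordCircuit _ L ++
      [⟨none, .one 0 hadamard⟩]))) 0)

theorem sum_joinVec_one {N : ℕ} (φ₀ φ₁ : Bits N → ℂ) :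
    (∑ z : Bits (N + 1), if z 0 = 1 then ‖joinVec φ₀ φ₁ z‖ ^ 2 else 0) = nsq φ₁ := by
  have h10 : (1 : Bit) ≠ 0 := by decide
  rw [sum_bits_succ]
  simp [joinVec, h10, h10.symm, nsq]

/-- Between the two Hadamard gates the state is (|0⟩φ + |1⟩Wφ)/√2, so the |1⟩ component at the end
is (1 - W)φ/2. -/
theorem outputProb_tester {ctl : ℕ → ℕ} {n m : ℕ} {S : Finset (Bits n)} (P : Prover n S (ctl m))
    (L : List (Σ y : BobQ n S, Bits y.ansLen)) (enc : (r : ℕ) → Bits r → PMF (Bits (ctl r)))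
    (c : Bits (ctl m)) :
    (P.tester L).outputProb enc c (zeroKet (P.N + 1)) =
      ∑ α, nsq ((1 - P.word L) *ᵥ (P.alice c α *ᵥ P.initial)) / 4 := by
  have hx : c ∘ Fin.elim0 = noInput := Subsingleton.elim _ _
  rw [tester, Adversary.outputProb]
  refine Finset.sum_congr rfl fun α _ => ?_
  rw [Adversary.outputProb, Circuit.mat_append, ← Matrix.mulVec_mulVec, zeroKet_succ,
    Circuit.mat_append, ← Matrix.mulVec_mulVec, Circuit.mat_lift_mulVec, Circuit.mat_lift_mulVec,
    outcomeProj_succ_mulVec, Circuit.mat_lift_mulVec, Circuit.mat,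
    ← Matrix.mulVec_mulVec, Circuit.mat_append, ← Matrix.mulVec_mulVec]
  simp only [Step.mat, Circuit.mat, Matrix.one_mul]
  rw [hadamard_mulVec_joinVec, wordCircuit_mulVec, hadamard_mulVec_joinVec, sum_joinVec_one]
  simp only [Function.comp_id, hx, Matrix.mulVec_zero, add_zero, sub_zero]
  have hφ : Circuit.mat P.post (Fin.append c α) *ᵥ (outcomeProj P.reg α *ᵥ
      (Circuit.mat P.pre c *ᵥ (Circuit.mat P.prep noInput *ᵥ zeroKet P.N))) =
      P.alice c α *ᵥ P.initial := by
    simp only [alice, initial, Matrix.mulVec_mulVec, Matrix.mul_assoc]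
  rw [hφ, Matrix.mulVec_smul, ← smul_sub, smul_smul, nsq_smul, Matrix.sub_mulVec,
    Matrix.one_mulVec, ← mul_inv, ← Complex.ofReal_mul, Real.mul_self_sqrt (by norm_num)]
  norm_num
  ring

theorem size_tester {ctl : ℕ → ℕ} {n m : ℕ} {S : Finset (Bits n)} (P : Prover n S (ctl m))
    (L : List (Σ y : BobQ n S, Bits y.ansLen)) {B : ℕ} (hB : ∀ y, (P.bob y).length ≤ B) :
    (P.tester L).size ≤ P.prep.length + P.pre.length + P.post.length + P.N +
      L.length * (2 * B + P.N) + 4 := by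
  have h1 := P.length_wordCircuit (k := ctl m + P.msgLen) hB L
  have h2 : P.msgLen ≤ P.N := by simpa using Fintype.card_le_of_embedding P.reg
  simp only [tester, Adversary.size, List.length_append, Circuit.length_lift, List.length_cons,
    List.length_nil]
  omega

end Prover

/-! ### The compiled game at a fixed security parameter -/

/-- A prover for the compiled tests at a fixed security parameter. -/
structure CompiledProver where
  E : EncryptionScheme
  lam : ℕ
  n : ℕ
  m : ℕ
  S : Finset (Bits n)
  encode : AliceQ n S → Bits m
  P : Prover n S (E.ctLen lam m)

namespace CompiledProver
variable (G : CompiledProver)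

/-- A secret key, a ciphertext, and an encrypted answer. -/
abbrev Branch : Type := Bits (G.E.keyLen G.lam) × Bits (G.E.ctLen G.lam G.m) × Bits G.P.msgLen

/-- Bob's binary observables. -/
abbrev Obs : Type := Σ y : BobQ G.n G.S, Bits y.ansLen

/-- Alice questions. -/
abbrev Query : Type := AliceQ G.n G.S

/-- The unnormalised state of the prover after Alice's answer. -/
noncomputable def branch (ω : G.Branch) : Bits G.P.N → ℂ := G.P.alice ω.2.1 ω.2.2 *ᵥ G.P.initial

/-- The weighted sum over all branches, for Alice's question `q`. -/
noncomputable def avg (q : G.Query) (f : G.Branch → ℝ) : ℝ :=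
  ∑ ω : G.Branch, (G.E.gen G.lam ω.1).toReal *
    (G.E.enc G.lam ω.1 G.m (G.encode q) ω.2.1).toReal * f ω

/-- The squared state-dependent norm of `R` for Alice's question `q`. -/
noncomputable def nrm (q : G.Query) (R : Matrix (Bits G.P.N) (Bits G.P.N) ℂ) : ℝ :=
  G.avg q fun ω => nsq (R *ᵥ G.branch ω)

variable {G}

theorem avg_mono (q : G.Query) {f g : G.Branch → ℝ} (h : ∀ ω, f ω ≤ g ω) :
    G.avg q f ≤ G.avg q g :=
  Finset.sum_le_sum fun ω _ => mul_le_mul_of_nonneg_left (h ω)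
    (mul_nonneg ENNReal.toReal_nonneg ENNReal.toReal_nonneg)

theorem avg_nonneg (q : G.Query) {f : G.Branch → ℝ} (h : ∀ ω, 0 ≤ f ω) : 0 ≤ G.avg q f :=
  Finset.sum_nonneg fun ω _ => mul_nonneg
    (mul_nonneg ENNReal.toReal_nonneg ENNReal.toReal_nonneg) (h ω)

theorem avg_add (q : G.Query) (f g : G.Branch → ℝ) :
    G.avg q (fun ω => f ω + g ω) = G.avg q f + G.avg q g := by
  simp [avg, mul_add, Finset.sum_add_distrib]

theorem avg_mul_left (q : G.Query) (c : ℝ) (f : G.Branch → ℝ) :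
    G.avg q (fun ω => c * f ω) = c * G.avg q f := by
  simp only [avg, Finset.mul_sum]
  exact Finset.sum_congr rfl fun _ _ => by ring

theorem avg_sum {β : Type} (s : Finset β) (q : G.Query) (f : β → G.Branch → ℝ) :
    G.avg q (fun ω => ∑ j ∈ s, f j ω) = ∑ j ∈ s, G.avg q (f j) := by
  simp only [avg, Finset.mul_sum]
  exact Finset.sum_comm

theorem avg_eq_expect (q : G.Query) (f : G.Branch → ℝ) :
    G.avg q f = expect (G.E.gen G.lam) fun sk =>
      expect (G.E.enc G.lam sk G.m (G.encode q)) fun c => ∑ α, f (sk, c, α) := by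
  simp only [avg, expect_eq_sum, Fintype.sum_prod_type, Finset.mul_sum, mul_assoc]

theorem avg_nsq_branch (q : G.Query) : G.avg q (fun ω => nsq (G.branch ω)) = 1 := by
  simp only [avg_eq_expect, branch, G.P.sum_nsq_alice, expect_const]

theorem stateNormSq_encState (q : G.Query) (R : Matrix (Bits G.P.N) (Bits G.P.N) ℂ) :
    stateNormSq R (encState G.E G.lam G.encode G.P q) = G.nrm q R := by
  rw [nrm, avg_eq_expect, encState]
  simp only [expect, stateNormSq_sum, stateNormSq_smul, smul_eq_mul]
  simp only [Prover.postState, stateNormSq_vecMulVec, branch]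

theorem challengeProb_tester (q : G.Query) (L : List G.Obs) :
    challengeProb G.E G.lam (G.P.tester (ctl := G.E.ctLen G.lam) L) (G.encode q) =
      G.nrm q (1 - G.P.word L) / 4 := by
  have h : G.nrm q (1 - G.P.word L) / 4 =
      G.avg q fun ω => nsq ((1 - G.P.word L) *ᵥ G.branch ω) / 4 := by
    rw [nrm, div_eq_inv_mul, ← avg_mul_left]
    congr 1
    funext ω
    rw [div_eq_inv_mul]
  rw [h, avg_eq_expect, challengeProb]
  simp only [Prover.outputProb_tester]
  rfl

variable (G) in
/-- Words of length at most `K` cannot distinguish encrypted questions with advantage more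
than `δ`. -/
def Indist (K : ℕ) (δ : ℝ) : Prop :=
  ∀ L : List G.Obs, L.length ≤ K → ∀ q q' : G.Query,
    G.nrm q (1 - G.P.word L) ≤ G.nrm q' (1 - G.P.word L) + δ

end CompiledProver

/-! ### From IND-CPA security to indistinguishability of short words -/

theorem exists_negligible_indist (E : EncryptionScheme) (hE : E.IsINDCPA) (n m : ℕ → ℕ)
    (S : (lam : ℕ) → Finset (Bits (n lam)))
    (encode : (lam : ℕ) → AliceQ (n lam) (S lam) → Bits (m lam)) (hm : PolyBounded m)
    (P : (lam : ℕ) → Prover (n lam) (S lam) (E.ctLen lam (m lam))) (hP : EfficientProver P)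
    (K : ℕ) :
    ∃ δ : ℕ → ℝ, Negligible δ ∧ ∀ lam, 0 ≤ δ lam ∧
      CompiledProver.Indist ⟨E, lam, n lam, m lam, S lam, encode lam, P lam⟩ K (δ lam) := by
  let G (lam : ℕ) : CompiledProver := ⟨E, lam, n lam, m lam, S lam, encode lam, P lam⟩
  -- IND-CPA bounds one family of adversaries and messages at a time. Taking the worst word and the
  -- worst pair of questions at each security parameter yields a single non-uniform family that
  -- dominates all choices.
  have hmax (lam : ℕ) : ∃ t : List (G lam).Obs × (G lam).Query × (G lam).Query,
      t.1.length ≤ K ∧ ∀ L : List (G lam).Obs, L.length ≤ K → ∀ q q' : (G lam).Query,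
        (G lam).nrm q (1 - (G lam).P.word L) - (G lam).nrm q' (1 - (G lam).P.word L) ≤
          |(G lam).nrm t.2.1 (1 - (G lam).P.word t.1) -
            (G lam).nrm t.2.2 (1 - (G lam).P.word t.1)| := by
    have hfin : {t : List (G lam).Obs × (G lam).Query × (G lam).Query |
        t.1.length ≤ K}.Finite := by
      have := (List.finite_length_le (G lam).Obs K).prod
        (Set.finite_univ (α := (G lam).Query × (G lam).Query))
      exact this.subset fun t ht => ⟨ht, trivial⟩
    obtain ⟨t, ht, hmax⟩ := Set.exists_max_image _
      (fun t => |(G lam).nrm t.2.1 (1 - (G lam).P.word t.1) -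
            (G lam).nrm t.2.2 (1 - (G lam).P.word t.1)|) hfin
      ⟨([], .tele, .tele), Nat.zero_le K⟩
    exact ⟨t, ht, fun L hL q q' => (le_abs_self _).trans (hmax (L, q, q') hL)⟩
  choose t htK ht using hmax
  -- The factor 4 undoes the quarter in the output probability of the Hadamard test.
  refine ⟨fun lam => 4 * |challengeProb E lam ((P lam).tester (ctl := E.ctLen lam) (t lam).1)
      (encode lam (t lam).2.1) - challengeProb E lam
        ((P lam).tester (ctl := E.ctLen lam) (t lam).1) (encode lam (t lam).2.2)|, ?_,
    fun lam => ⟨by positivity, fun L hL q q' => ?_⟩⟩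
  · obtain ⟨p, hp⟩ := hP
    refine Asymptotics.SuperpolynomialDecay.const_mul (hE m _ _ (fun lam => (P lam).N + 1) _ hm
      ⟨p + 1, fun lam => ?_⟩ ⟨p + Polynomial.C K * (2 * p + p) + 4, fun lam => ?_⟩) 4
    · have h1 := hp lam
      beta_reduce at h1
      simp only [Polynomial.eval_add, Polynomial.eval_one]
      omega
    · have h1 := hp lam
      beta_reduce at h1
      have hB (y : BobQ (n lam) (S lam)) : ((P lam).bob y).length ≤ p.eval lam :=
        (Finset.le_sup (f := fun y => ((P lam).bob y).length) (Finset.mem_univ y)).trans (by omega)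
      refine ((P lam).size_tester (ctl := E.ctLen lam) (t lam).1 hB).trans ?_
      have h2 : (t lam).1.length * (2 * p.eval lam + (P lam).N) ≤
          K * (2 * p.eval lam + p.eval lam) :=
        Nat.mul_le_mul (htK lam) (by omega)
      simp only [Polynomial.eval_add, Polynomial.eval_mul, Polynomial.eval_C,
        Polynomial.eval_ofNat]
      omega
  · have h1 := CompiledProver.challengeProb_tester (G := G lam) (t lam).2.1 (t lam).1
    have h2 := CompiledProver.challengeProb_tester (G := G lam) (t lam).2.2 (t lam).1
    have h3 := ht lam L hL q q'
    have h4 : 4 * |challengeProb E lam ((P lam).tester (ctl := E.ctLen lam) (t lam).1)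
      (encode lam (t lam).2.1) - challengeProb E lam
        ((P lam).tester (ctl := E.ctLen lam) (t lam).1) (encode lam (t lam).2.2)| =
        |(G lam).nrm (t lam).2.1 (1 - (G lam).P.word (t lam).1) -
            (G lam).nrm (t lam).2.2 (1 - (G lam).P.word (t lam).1)| := by
      rw [h1, h2, ← sub_div, abs_div, abs_of_pos (by norm_num : (0 : ℝ) < 4)]
      ring
    exact sub_le_iff_le_add'.mp (h3.trans_eq h4.symm)

/-! ### Rejection probabilities -/

namespace CompiledProver
variable (G : CompiledProver)

open Classical in
/-- The probability that the verifier rejects on the question pair `(x, y)`. -/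
noncomputable def rej (x : G.Query) (y : BobQ G.n G.S) : ℝ :=
  G.avg x fun ω => ∑ v, if accepts x y (G.E.dec G.lam ω.1 (List.ofFn ω.2.2)) v then 0
    else nsq (G.P.bobProj y v *ᵥ G.branch ω)

theorem rej_nonneg (x : G.Query) (y : BobQ G.n G.S) : 0 ≤ G.rej x y :=
  avg_nonneg _ fun ω => Finset.sum_nonneg fun v _ => by
    split_ifs
    · rfl
    · exact nsq_nonneg _

theorem rej_le_one (x : G.Query) (y : BobQ G.n G.S) : G.rej x y ≤ 1 := by
  rw [← G.avg_nsq_branch x]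
  refine avg_mono _ fun ω => ?_
  rw [← (G.P.isProjMeas_bobProj y).sum_nsq]
  refine Finset.sum_le_sum fun v _ => ?_
  split_ifs
  · exact nsq_nonneg _
  · rfl

theorem winProb_eq (dist : PMF (G.Query × BobQ G.n G.S)) :
    winProb G.E G.lam G.encode G.P dist = 1 - expect dist fun xy => G.rej xy.1 xy.2 := by
  have h (xy : G.Query × BobQ G.n G.S) : (expect (G.E.gen G.lam) fun sk =>
      expect (G.E.enc G.lam sk G.m (G.encode xy.1)) fun c => ∑ α : Bits G.P.msgLen,
        ∑ v : Bits xy.2.ansLen, open Classical in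
          if accepts xy.1 xy.2 (G.E.dec G.lam sk (List.ofFn α)) v
          then (G.P.bobProj xy.2 v * G.P.postState c α).trace.re else 0) =
      1 - G.rej xy.1 xy.2 := by
    rw [eq_sub_iff_add_eq, ← G.avg_nsq_branch xy.1, rej, ← avg_eq_expect (G := G) xy.1
      (fun ω => ∑ v : Bits xy.2.ansLen, open Classical in
          if accepts xy.1 xy.2 (G.E.dec G.lam ω.1 (List.ofFn ω.2.2)) v
          then (G.P.bobProj xy.2 v * G.P.postState ω.2.1 ω.2.2).trace.re else 0), ← avg_add]
    congr 1
    funext ω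
    rw [← Finset.sum_add_distrib, ← (G.P.isProjMeas_bobProj xy.2).sum_nsq]
    refine Finset.sum_congr rfl fun v _ => ?_
    split_ifs
    · rw [Prover.postState, trace_mul_vecMulVec, add_zero]
      erw [(G.P.isProjMeas_bobProj xy.2).dotProduct_mulVec]
      rfl
    · rw [zero_add]
  have h1 : (1 : ℝ) = expect dist fun _ => 1 := (expect_const dist 1).symm
  rw [winProb]
  simp only [h]
  rw [eq_sub_iff_add_eq, ← expect_add]
  simp only [sub_add_cancel, expect_const]

end CompiledProver

namespace CompiledProver
variable (G : CompiledProver)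

/-! ### Approximate relations between words -/

/-- The words `L₁` and `(-1)^β L₂` agree up to `e` for every encrypted question. -/
def Rel (L₁ : List G.Obs) (β : Bit) (L₂ : List G.Obs) (e : ℝ) : Prop :=
  ∀ q, G.nrm q (G.P.word L₁ - sgn β • G.P.word L₂) ≤ e

/-- On the encrypted question `q` the branches are eigenvectors of `o` with eigenvalues
`(-1)^τ`, up to `κ`. -/
def Consistent (q : G.Query) (o : G.Obs) (τ : G.Branch → Bit) (κ : ℝ) : Prop :=
  G.avg q (fun ω => nsq (G.P.obs o *ᵥ G.branch ω - sgn (τ ω) • G.branch ω)) ≤ κ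

variable {G}

theorem nrm_word_mul (q : G.Query) (L : List G.Obs) (R : Matrix (Bits G.P.N) (Bits G.P.N) ℂ) :
    G.nrm q (G.P.word L * R) = G.nrm q R := by
  simp only [nrm, ← Matrix.mulVec_mulVec, Prover.nsq_word_mulVec]

theorem nrm_sgn_smul (q : G.Query) (β : Bit) (R : Matrix (Bits G.P.N) (Bits G.P.N) ℂ) :
    G.nrm q (sgn β • R) = G.nrm q R := by
  simp only [nrm, Matrix.smul_mulVec, nsq_sgn_smul]

theorem nrm_add_le (q : G.Query) (R R' : Matrix (Bits G.P.N) (Bits G.P.N) ℂ) :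
    G.nrm q (R + R') ≤ 2 * G.nrm q R + 2 * G.nrm q R' := by
  rw [nrm, nrm, nrm, ← avg_mul_left, ← avg_mul_left, ← avg_add]
  refine avg_mono _ fun ω => ?_
  rw [Matrix.add_mulVec]
  exact nsq_add_le _ _

theorem nrm_add_three_le (q : G.Query) (R R' R'' : Matrix (Bits G.P.N) (Bits G.P.N) ℂ) :
    G.nrm q (R + R' + R'') ≤ 3 * (G.nrm q R + G.nrm q R' + G.nrm q R'') := by
  rw [nrm, nrm, nrm, nrm, ← avg_add, ← avg_add, ← avg_mul_left]
  refine avg_mono _ fun ω => ?_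
  rw [Matrix.add_mulVec, Matrix.add_mulVec]
  exact nsq_add_three_le _ _ _

/-- Parallelogram law for a unitary word. It lets the same Hadamard test treat relations with a
minus sign. -/
theorem nrm_one_add_word (q : G.Query) (L : List G.Obs) :
    G.nrm q (1 + G.P.word L) = 4 - G.nrm q (1 - G.P.word L) := by
  have h : G.nrm q (1 + G.P.word L) + G.nrm q (1 - G.P.word L) =
      G.avg q fun ω => 4 * nsq (G.branch ω) := by
    rw [nrm, nrm, ← avg_add]
    congr 1
    funext ω
    rw [Matrix.add_mulVec, Matrix.sub_mulVec, nsq_add_add_nsq_sub, Matrix.one_mulVec,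
      Prover.nsq_word_mulVec]
    ring
  rw [avg_mul_left, avg_nsq_branch] at h
  linarith

/-- Factor out the unitary L₁ on the left: what remains is 1 ∓ L₁⁻¹L₂, with L₁⁻¹L₂ a word of the
combined length. -/
theorem Indist.le {K : ℕ} {δ : ℝ} (h : G.Indist K δ) {L₁ L₂ : List G.Obs}
    (hK : L₁.length + L₂.length ≤ K) (β : Bit) (q q' : G.Query) :
    G.nrm q (G.P.word L₁ - sgn β • G.P.word L₂) ≤
      G.nrm q' (G.P.word L₁ - sgn β • G.P.word L₂) + δ := by
  have hw : G.P.word L₁ - sgn β • G.P.word L₂ =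
      G.P.word L₁ * (1 - sgn β • G.P.word (L₁.reverse ++ L₂)) := by
    rw [mul_sub, mul_one, mul_smul_comm, Prover.word_append, ← mul_assoc,
      Prover.word_mul_word_reverse, one_mul]
  rw [hw, nrm_word_mul, nrm_word_mul]
  have hl : (L₁.reverse ++ L₂).length ≤ K := by simpa using hK
  rcases bit_cases β with rfl | rfl
  · rw [sgn_zero, one_smul]
    exact h _ hl q q'
  · rw [sgn_one, neg_one_smul, sub_neg_eq_add, nrm_one_add_word, nrm_one_add_word]
    -- Passing from 1 + W to 1 - W reverses the inequality, so the roles of q and q' are exchanged.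
    linarith [h _ hl q' q]

theorem Indist.rel {K : ℕ} {δ : ℝ} (h : G.Indist K δ) {L₁ L₂ : List G.Obs} {β : Bit} {e : ℝ}
    (q : G.Query) (hq : G.nrm q (G.P.word L₁ - sgn β • G.P.word L₂) ≤ e)
    (hK : L₁.length + L₂.length ≤ K) : G.Rel L₁ β L₂ (e + δ) :=
  fun q' => (h.le hK β q' q).trans (by linarith)

theorem Rel.cons {L₁ L₂ : List G.Obs} {β : Bit} {e : ℝ} (h : G.Rel L₁ β L₂ e) (o : G.Obs) :
    G.Rel (o :: L₁) β (o :: L₂) e := fun q => by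
  have hw : G.P.word (o :: L₁) - sgn β • G.P.word (o :: L₂) =
      G.P.word [o] * (G.P.word L₁ - sgn β • G.P.word L₂) := by
    simp [Prover.word_cons, Prover.word_nil, mul_sub]
  rw [hw, nrm_word_mul]
  exact h q

theorem Rel.trans {L₁ L₂ L₃ : List G.Obs} {β β' : Bit} {e e' : ℝ} (h : G.Rel L₁ β L₂ e)
    (h' : G.Rel L₂ β' L₃ e') : G.Rel L₁ (β + β') L₃ (2 * e + 2 * e') := fun q => by
  have hw : G.P.word L₁ - sgn (β + β') • G.P.word L₃ =
      (G.P.word L₁ - sgn β • G.P.word L₂) + sgn β • (G.P.word L₂ - sgn β' • G.P.word L₃) := by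
    rw [sgn_add, smul_sub, smul_smul]
    abel
  rw [hw]
  have h1 := nrm_add_le q (G.P.word L₁ - sgn β • G.P.word L₂)
    (sgn β • (G.P.word L₂ - sgn β' • G.P.word L₃))
  rw [nrm_sgn_smul] at h1
  linarith [h q, h' q]

theorem nrm_symm (q : G.Query) (L₁ L₂ : List G.Obs) (β : Bit) :
    G.nrm q (G.P.word L₂ - sgn β • G.P.word L₁) =
      G.nrm q (G.P.word L₁ - sgn β • G.P.word L₂) := by
  have hw : G.P.word L₁ - sgn β • G.P.word L₂ =
      sgn (1 + β) • (G.P.word L₂ - sgn β • G.P.word L₁) := by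
    rw [sgn_add, sgn_one, smul_sub, smul_smul, mul_assoc, sgn_mul_self]
    simp only [neg_mul, one_mul, mul_one, neg_smul, one_smul]
    abel
  rw [hw, nrm_sgn_smul]

theorem Rel.symm {L₁ L₂ : List G.Obs} {β : Bit} {e : ℝ} (h : G.Rel L₁ β L₂ e) :
    G.Rel L₂ β L₁ e := fun q => by
  rw [nrm_symm]
  exact h q

/-- Replacing `o` by its approximate eigenvalue costs ‖R‖² ≤ 4 times κ, doubled by the triangle
inequality for squares. -/
theorem Consistent.nrm_mul_le {q : G.Query} {o : G.Obs} {τ : G.Branch → Bit} {κ : ℝ}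
    (h : G.Consistent q o τ κ) (L₁ L₂ : List G.Obs) (β : Bit) :
    G.nrm q ((G.P.word L₁ - sgn β • G.P.word L₂) * G.P.obs o) ≤
      2 * G.nrm q (G.P.word L₁ - sgn β • G.P.word L₂) + 8 * κ := by
  set R := G.P.word L₁ - sgn β • G.P.word L₂ with hR
  have hbound (v : Bits G.P.N → ℂ) : nsq (R *ᵥ v) ≤ 4 * nsq v := by
    rw [hR, Matrix.sub_mulVec, Matrix.smul_mulVec]
    refine (nsq_sub_le _ _).trans ?_
    rw [nsq_sgn_smul, Prover.nsq_word_mulVec, Prover.nsq_word_mulVec]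
    linarith
  calc G.nrm q (R * G.P.obs o)
      ≤ G.avg q fun ω => 2 * nsq (R *ᵥ G.branch ω) +
          8 * nsq (G.P.obs o *ᵥ G.branch ω - sgn (τ ω) • G.branch ω) := by
        refine avg_mono _ fun ω => ?_
        have hv : (R * G.P.obs o) *ᵥ G.branch ω = sgn (τ ω) • (R *ᵥ G.branch ω) +
            R *ᵥ (G.P.obs o *ᵥ G.branch ω - sgn (τ ω) • G.branch ω) := by
          rw [Matrix.mulVec_sub, Matrix.mulVec_smul, Matrix.mulVec_mulVec]
          abel
        rw [hv]
        refine (nsq_add_le _ _).trans ?_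
        rw [nsq_sgn_smul]
        linarith [hbound (G.P.obs o *ᵥ G.branch ω - sgn (τ ω) • G.branch ω)]
    _ ≤ 2 * G.nrm q R + 8 * κ := by
        rw [avg_add, avg_mul_left, avg_mul_left]
        have : G.avg q (fun ω => nsq (G.P.obs o *ᵥ G.branch ω - sgn (τ ω) • G.branch ω)) ≤ κ := h
        unfold nrm
        linarith

/-- Multiplication on the right: it is carried out on the one question q where `o` acts nearly as a
sign, and the result is transported to every question by indistinguishability. -/
theorem Rel.concat {K : ℕ} {δ : ℝ} (hG : G.Indist K δ) {L₁ L₂ : List G.Obs} {β : Bit} {e : ℝ}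
    (h : G.Rel L₁ β L₂ e) {q : G.Query} {o : G.Obs} {τ : G.Branch → Bit} {κ : ℝ}
    (ho : G.Consistent q o τ κ) (hK : L₁.length + L₂.length + 2 ≤ K) :
    G.Rel (L₁ ++ [o]) β (L₂ ++ [o]) (2 * e + 8 * κ + δ) := by
  refine hG.rel q ?_ (by simp; omega)
  have h1 := ho.nrm_mul_le L₁ L₂ β
  have hw : (G.P.word L₁ - sgn β • G.P.word L₂) * G.P.obs o =
      G.P.word (L₁ ++ [o]) - sgn β • G.P.word (L₂ ++ [o]) := by
    simp [Prover.word_append, Prover.word_cons, Prover.word_nil, sub_mul]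
  rw [← hw]
  linarith [h q]

/-- On q each branch is nearly a common eigenvector, so an identity between the eigenvalues becomes
one between the operators. -/
theorem Consistent.rel_mul {K : ℕ} {δ : ℝ} (hG : G.Indist K δ) (hK : 3 ≤ K) {q : G.Query}
    {x y z : G.Obs} {τx τy τz : G.Branch → Bit} {κ : ℝ} (hx : G.Consistent q x τx κ)
    (hy : G.Consistent q y τy κ) (hz : G.Consistent q z τz κ) {β : Bit}
    (hτ : ∀ ω, τx ω + τy ω = β + τz ω) : G.Rel [x, y] β [z] (9 * κ + δ) := by
  refine hG.rel q ?_ hK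
  calc G.nrm q (G.P.word [x, y] - sgn β • G.P.word [z])
      ≤ G.avg q fun ω => 3 * (nsq (G.P.obs y *ᵥ G.branch ω - sgn (τy ω) • G.branch ω) +
          nsq (G.P.obs x *ᵥ G.branch ω - sgn (τx ω) • G.branch ω) +
          nsq (G.P.obs z *ᵥ G.branch ω - sgn (τz ω) • G.branch ω)) := by
        refine avg_mono _ fun ω => ?_
        have hv : (G.P.word [x, y] - sgn β • G.P.word [z]) *ᵥ G.branch ω =
            G.P.obs x *ᵥ (G.P.obs y *ᵥ G.branch ω - sgn (τy ω) • G.branch ω) +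
            sgn (τy ω) • (G.P.obs x *ᵥ G.branch ω - sgn (τx ω) • G.branch ω) +
            sgn (1 + β) • (G.P.obs z *ᵥ G.branch ω - sgn (τz ω) • G.branch ω) := by
          have hs : sgn (τy ω) * sgn (τx ω) = sgn β * sgn (τz ω) := by
            rw [← sgn_add, ← sgn_add, add_comm, hτ]
          simp only [Prover.word_cons, Prover.word_nil, Matrix.sub_mulVec, Matrix.mulVec_sub,
            Matrix.mulVec_smul, Matrix.smul_mulVec, Matrix.mulVec_mulVec, mul_one, smul_sub,
            smul_smul, hs, sgn_add, sgn_one, neg_mul, one_mul, neg_smul]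
          abel
        rw [hv]
        refine (nsq_add_three_le _ _ _).trans ?_
        rw [nsq_sgn_smul, nsq_sgn_smul, Prover.nsq_obs_mulVec]
    _ ≤ 9 * κ := by
        rw [avg_mul_left, avg_add, avg_add]
        unfold Consistent at hx hy hz
        linarith

/-- Both products act on q as the product of the two eigenvalues. -/
theorem Consistent.rel_comm {K : ℕ} {δ : ℝ} (hG : G.Indist K δ) (hK : 4 ≤ K) {q : G.Query}
    {x y : G.Obs} {τx τy : G.Branch → Bit} {κ : ℝ} (hx : G.Consistent q x τx κ)
    (hy : G.Consistent q y τy κ) : G.Rel [x, y] 0 [y, x] (16 * κ + δ) := by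
  refine hG.rel q ?_ hK
  calc G.nrm q (G.P.word [x, y] - sgn 0 • G.P.word [y, x])
      ≤ G.avg q fun ω => 8 * (nsq (G.P.obs y *ᵥ G.branch ω - sgn (τy ω) • G.branch ω) +
          nsq (G.P.obs x *ᵥ G.branch ω - sgn (τx ω) • G.branch ω)) := by
        refine avg_mono _ fun ω => ?_
        have hv : (G.P.word [x, y] - sgn 0 • G.P.word [y, x]) *ᵥ G.branch ω =
            (G.P.obs x *ᵥ (G.P.obs y *ᵥ G.branch ω - sgn (τy ω) • G.branch ω) +
              sgn (τy ω) • (G.P.obs x *ᵥ G.branch ω - sgn (τx ω) • G.branch ω)) -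
            (G.P.obs y *ᵥ (G.P.obs x *ᵥ G.branch ω - sgn (τx ω) • G.branch ω) +
              sgn (τx ω) • (G.P.obs y *ᵥ G.branch ω - sgn (τy ω) • G.branch ω)) := by
          simp only [Prover.word_cons, Prover.word_nil, Matrix.sub_mulVec, Matrix.mulVec_sub,
            Matrix.mulVec_smul, Matrix.mulVec_mulVec, mul_one, smul_sub,
            smul_smul, sgn_zero, one_smul, mul_comm (sgn (τx ω))]
          abel
        rw [hv]
        refine (nsq_sub_le _ _).trans ?_
        have h1 := nsq_add_le (G.P.obs x *ᵥ (G.P.obs y *ᵥ G.branch ω - sgn (τy ω) • G.branch ω))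
          (sgn (τy ω) • (G.P.obs x *ᵥ G.branch ω - sgn (τx ω) • G.branch ω))
        have h2 := nsq_add_le (G.P.obs y *ᵥ (G.P.obs x *ᵥ G.branch ω - sgn (τx ω) • G.branch ω))
          (sgn (τx ω) • (G.P.obs y *ᵥ G.branch ω - sgn (τy ω) • G.branch ω))
        rw [nsq_sgn_smul, Prover.nsq_obs_mulVec] at h1 h2
        linarith
    _ ≤ 16 * κ := by
        rw [avg_mul_left, avg_add]
        unfold Consistent at hx hy
        linarith

theorem Consistent.nrm_sub_le {q : G.Query} {x y : G.Obs} {τ : G.Branch → Bit} {κ κ' : ℝ}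
    (hx : G.Consistent q x τ κ) (hy : G.Consistent q y τ κ') :
    G.nrm q (G.P.word [x] - sgn 0 • G.P.word [y]) ≤ 2 * κ + 2 * κ' := by
  calc G.nrm q (G.P.word [x] - sgn 0 • G.P.word [y])
      ≤ G.avg q fun ω => 2 * nsq (G.P.obs x *ᵥ G.branch ω - sgn (τ ω) • G.branch ω) +
          2 * nsq (G.P.obs y *ᵥ G.branch ω - sgn (τ ω) • G.branch ω) := by
        refine avg_mono _ fun ω => ?_
        have hv : (G.P.word [x] - sgn 0 • G.P.word [y]) *ᵥ G.branch ω =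
            (G.P.obs x *ᵥ G.branch ω - sgn (τ ω) • G.branch ω) -
            (G.P.obs y *ᵥ G.branch ω - sgn (τ ω) • G.branch ω) := by
          simp [Prover.word_cons, Prover.word_nil, Matrix.sub_mulVec, sgn_zero]
        rw [hv]
        exact nsq_sub_le _ _
    _ ≤ _ := by
        rw [avg_add, avg_mul_left, avg_mul_left]
        unfold Consistent at hx hy
        linarith

/-! ### The magic square -/

/-- xy ≈ (pr)y = p(ry) ≈ pz: two lines of the square that share the cell r turn one product into
another. -/
theorem Rel.exchange {K : ℕ} {δ : ℝ} (hG : G.Indist K δ) (hK : 5 ≤ K) {p r x y z : G.Obs}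
    {β β' : Bit} {κ : ℝ} (h : G.Rel [p, r] β [x] (9 * κ + δ))
    (h' : G.Rel [r, y] β' [z] (9 * κ + δ)) {q : G.Query} {τ : G.Branch → Bit}
    (hy : G.Consistent q y τ κ) : G.Rel [x, y] (β + β') [p, z] (70 * κ + 8 * δ) := by
  have h1 : G.Rel [x, y] β [p, r, y] _ := Rel.concat hG h.symm hy hK
  have h2 := h1.trans (h'.cons p)
  intro q'
  linarith [h2 q']

theorem add_eq_sum_add_of_ne (f : Fin 3 → Bit) (i j k : Fin 3) (hij : i ≠ j) (hjk : j ≠ k)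
    (hik : i ≠ k) : f i + f j = ∑ t, f t + f k := by
  rw [Fin.sum_univ_three]
  have h2 (a : Bit) : a + a = 0 := bit_add_self a
  fin_cases i <;> fin_cases j <;> fin_cases k <;> simp_all <;> grind

theorem rel_magicSquare {K : ℕ} {δ : ℝ} (hG : G.Indist K δ) (hK : 5 ≤ K) (c : Cell → G.Obs)
    {κ : ℝ} (hc : ∀ l : Line, ∃ (q : G.Query) (τ : Fin 3 → G.Branch → Bit),
      (∀ ω, ∑ k, τ k ω = l.parity) ∧ ∀ k, G.Consistent q (c (l.cell k)) (τ k) κ) :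
    G.Rel [c (0, 1), c (1, 0)] 1 [c (1, 0), c (0, 1)] (700 * κ + 80 * δ) := by
  have line (l : Line) (i j k : Fin 3) (hij : i ≠ j) (hjk : j ≠ k) (hik : i ≠ k) :
      G.Rel [c (l.cell i), c (l.cell j)] l.parity [c (l.cell k)] (9 * κ + δ) := by
    obtain ⟨q, τ, hτ, h⟩ := hc l
    refine (h i).rel_mul hG (by omega) (h j) (h k) fun ω => ?_
    rw [← hτ ω]
    exact add_eq_sum_add_of_ne (fun t => τ t ω) i j k hij hjk hik
  have cons (l : Line) (k : Fin 3) : ∃ (q : G.Query) (τ : G.Branch → Bit),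
      G.Consistent q (c (l.cell k)) τ κ := by
    obtain ⟨q, τ, -, h⟩ := hc l
    exact ⟨q, τ k, h k⟩
  obtain ⟨_, _, h10⟩ := cons (.row 1) 0
  obtain ⟨_, _, h20⟩ := cons (.row 2) 0
  obtain ⟨_, _, h01⟩ := cons (.row 0) 1
  -- With c_ij the cells, the chain is c₀₁c₁₀ ≈ c₀₂c₂₀ ≈ c₁₂c₂₁ ≈ c₁₀c₀₁, up to signs.
  have s1 := Rel.exchange hG hK (line (.row 0) 2 0 1 (by decide) (by decide) (by decide))
    (line (.col 0) 0 1 2 (by decide) (by decide) (by decide)) h10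
  have s2 := Rel.exchange hG hK (line (.col 2) 1 2 0 (by decide) (by decide) (by decide))
    (line (.row 2) 2 0 1 (by decide) (by decide) (by decide)) h20
  have s3 := Rel.exchange hG hK (line (.row 1) 2 1 0 (by decide) (by decide) (by decide))
    (line (.col 1) 1 0 2 (by decide) (by decide) (by decide)) h01
  have h := (s1.trans s2).trans s3.symm
  -- Every line is used exactly once and the three columns are odd, which produces the minus sign.
  have hb : Line.parity (.row 0) + Line.parity (.col 0) +
      (Line.parity (.col 2) + Line.parity (.row 2)) +
      (Line.parity (.row 1) + Line.parity (.col 1)) = 1 := by decide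
  rw [hb] at h
  intro q
  have := h q
  simp only [Line.cell] at this
  linarith

/-! ### Consistency from the tests -/

variable (G) in
/-- Alice's decrypted answer. -/
def answer (ω : G.Branch) : List Bit := G.E.dec G.lam ω.1 (List.ofFn ω.2.2)

/-- An accepted outcome contributes nothing to the eigenvector defect, a rejected one at most 4
times its weight. -/
theorem consistent_of_accepts (x : G.Query) (y : BobQ G.n G.S) (a : Bits y.ansLen)
    (τ : G.Branch → Bit) (h : ∀ ω v, accepts x y (G.answer ω) v → a ⬝ᵥ v = τ ω) :
    G.Consistent x ⟨y, a⟩ τ (4 * G.rej x y) := by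
  rw [Consistent, rej, ← avg_mul_left]
  refine avg_mono _ fun ω => ?_
  rw [Prover.nsq_obs_mulVec_sub, Finset.mul_sum]
  refine Finset.sum_le_sum fun v _ => ?_
  split_ifs with hv
  · have : a ⬝ᵥ v + τ ω = 0 := by rw [h ω v hv, bit_add_self]
    simp [this, sgn_zero]
  · refine mul_le_mul_of_nonneg_right ?_ (nsq_nonneg _)
    have h1 := Complex.abs_re_le_norm (sgn (a ⬝ᵥ v + τ ω))
    rw [norm_sgn, abs_le] at h1
    linarith [h1.1]

theorem Consistent.mono {q : G.Query} {o : G.Obs} {τ : G.Branch → Bit} {κ κ' : ℝ}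
    (h : G.Consistent q o τ κ) (hκ : κ ≤ κ') : G.Consistent q o τ κ' := le_trans h hκ

variable (G) in
/-- Alice's decrypted answer, read as a string of `n` bits. -/
def answerBits (ω : G.Branch) : Bits G.n := fun i => (G.answer ω).getD i 0

variable (G) in
/-- Bob's observable `W(a)`. -/
def pauli (W : Basis) (a : Bits G.n) : G.Obs := ⟨.basis W, a⟩

theorem consistent_pauli (W : Basis) (a : Bits G.n) :
    G.Consistent (.basis W) (G.pauli W a) (fun ω => a ⬝ᵥ G.answerBits ω)
      (4 * G.rej (.basis W) (.basis W)) := by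
  refine consistent_of_accepts _ _ _ _ fun ω v hv => ?_
  have h : G.answerBits ω = v := funext hv
  rw [h]
  rfl

theorem consistent_mixed (W : Basis) (w : PauliString G.n) (a : Bits G.n)
    (ha : ∀ i, w i ≠ W.toPauli → a i = 0) :
    G.Consistent (.basis W) ⟨.mixed w, a⟩ (fun ω => a ⬝ᵥ G.answerBits ω)
      (4 * G.rej (.basis W) (.mixed w)) := by
  refine consistent_of_accepts _ _ _ _ fun ω v hv => ?_
  refine Finset.sum_congr rfl fun i _ => ?_
  by_cases hi : w i = W.toPauli
  · have h : G.answerBits ω i = (v : Bits G.n) i := hv i hi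
    rw [h]
  · have h := ha i hi
    change a i * _ = a i * _
    rw [h, zero_mul, zero_mul]

theorem rel_pauli_of_commutation {K : ℕ} {δ : ℝ} (hG : G.Indist K δ) (hK : 4 ≤ K) (a b : G.S) :
    G.Rel [G.pauli .Z a, G.pauli .X b] 0 [G.pauli .X b, G.pauli .Z a]
      (128 * expect (commutationDist a b) (fun xy => G.rej xy.1 xy.2) + δ) := by
  -- Each of the two bases is asked with probability 1/2, hence 8 = 4 · 2; then 128 = 16 · 8.
  have hR (W : Basis) : 4 * G.rej (.com a b) (.basis W) ≤
      8 * expect (commutationDist a b) (fun xy => G.rej xy.1 xy.2) := by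
    rw [commutationDist, expect_map]
    have := le_card_mul_expect_uniform (fun W : Basis => G.rej (.com a b) (.basis W))
      (fun W => G.rej_nonneg _ _) W
    have hc : Fintype.card Basis = 2 := rfl
    rw [hc] at this
    push_cast at this
    linarith
  have hZ : G.Consistent (.com a b) (G.pauli .Z a) _ _ :=
    (consistent_of_accepts (.com a b) (.basis .Z) a.1 (fun ω => (G.answer ω).getD 0 0)
      fun ω v hv => hv).mono (hR .Z)
  have hX : G.Consistent (.com a b) (G.pauli .X b) _ _ :=
    (consistent_of_accepts (.com a b) (.basis .X) b.1 (fun ω => (G.answer ω).getD 1 0)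
      fun ω v hv => hv).mono (hR .X)
  intro q
  linarith [hZ.rel_comm hG hK hX q]

variable (G) in
/-- Bob's observable for a cell of the magic square. -/
def cellObs (a b : G.S) (j : Cell) : G.Obs :=
  if j = (0, 1) then G.pauli .Z a else if j = (1, 0) then G.pauli .X b else ⟨.ms a b j, 1⟩

variable (G) in
/-- Alice's answers on a line of the magic square, the last bit corrected to have the
right parity. -/
def lineAnswer (l : Line) (k : Fin 3) (ω : G.Branch) : Bit :=
  if k = 2 then l.parity + (G.answer ω).getD 0 0 + (G.answer ω).getD 1 0
  else (G.answer ω).getD k 0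

/-- `rel_magicSquare` needs the parity on every branch, including those on which Alice's own answer
violates it; `lineAnswer_eq` shows that correcting it changes nothing on accepted answers. -/
theorem sum_lineAnswer (l : Line) (ω : G.Branch) : ∑ k, G.lineAnswer l k ω = l.parity := by
  rw [Fin.sum_univ_three]
  simp only [lineAnswer]
  have h0 := bit_add_self ((G.answer ω).getD 0 0)
  have h1 := bit_add_self ((G.answer ω).getD 1 0)
  simp
  grind

theorem lineAnswer_eq {l : Line} {ω : G.Branch}
    (h : ∑ k : Fin 3, (G.answer ω).getD k 0 = l.parity) (k : Fin 3) :
    G.lineAnswer l k ω = (G.answer ω).getD k 0 := by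
  by_cases hk : k = 2
  · subst hk
    rw [lineAnswer, if_pos rfl, ← h, Fin.sum_univ_three]
    have h0 := bit_add_self ((G.answer ω).getD 0 0)
    have h1 := bit_add_self ((G.answer ω).getD 1 0)
    simp
    grind
  · rw [lineAnswer, if_neg hk]

theorem Line.cell_injective (l : Line) : Function.Injective l.cell := by
  intro i j h
  cases l <;> simp_all [Line.cell]

theorem consistent_cellObs (a b : G.S) (l : Line) (k : Fin 3) :
    G.Consistent (.ms a b l) (G.cellObs a b (l.cell k)) (G.lineAnswer l k)
      (4 * G.rej (.ms a b l) (cellQuestion a b (l.cell k))) := by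
  rw [cellObs, cellQuestion]
  split_ifs with h1 h2
  · refine consistent_of_accepts _ _ _ _ fun ω v hv => ?_
    obtain ⟨hp, k', hk', hv⟩ := hv
    rw [← h1] at hk'
    rw [lineAnswer_eq hp, ← Line.cell_injective l hk', ← hv]
    rfl
  · refine consistent_of_accepts _ _ _ _ fun ω v hv => ?_
    obtain ⟨hp, k', hk', hv⟩ := hv
    rw [← h2] at hk'
    rw [lineAnswer_eq hp, ← Line.cell_injective l hk', ← hv]
    rfl
  · refine consistent_of_accepts _ _ _ _ fun ω v hv => ?_
    obtain ⟨hp, k', hk', hv⟩ := hv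
    rw [lineAnswer_eq hp, ← Line.cell_injective l hk', hv]
    exact (Fin.sum_univ_one _).trans (one_mul _)

theorem rel_pauli_of_anticommutation {K : ℕ} {δ : ℝ} (hG : G.Indist K δ) (hK : 5 ≤ K)
    (a b : G.S) :
    G.Rel [G.pauli .Z a, G.pauli .X b] 1 [G.pauli .X b, G.pauli .Z a]
      (50400 * expect (anticommutationDist a b) (fun xy => G.rej xy.1 xy.2) + 80 * δ) := by
  -- There are 18 equally likely pairs of a cell and a line through it, hence 72 = 4 · 18; then
  -- 50400 = 700 · 72.
  have hR (l : Line) (k : Fin 3) : 4 * G.rej (.ms a b l) (cellQuestion a b (l.cell k)) ≤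
      72 * expect (anticommutationDist a b) (fun xy => G.rej xy.1 xy.2) := by
    rw [anticommutationDist, expect_map]
    have h (jo : Cell × Bool) := le_card_mul_expect_uniform (fun jo : Cell × Bool =>
      G.rej (.ms a b (if jo.2 then .row jo.1.1 else .col jo.1.2)) (cellQuestion a b jo.1))
      (fun jo => G.rej_nonneg _ _) jo
    have hc : Fintype.card (Cell × Bool) = 18 := rfl
    simp only [hc] at h
    push_cast at h
    cases l with
    | row i =>
      have := h ((i, k), true)
      simp only [if_true] at this
      simp only [Line.cell]
      linarith
    | col j =>
      have := h ((k, j), false)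
      simp only [Bool.false_eq_true, if_false] at this
      simp only [Line.cell]
      linarith
  have h := rel_magicSquare hG hK (G.cellObs a b) fun l =>
    ⟨.ms a b l, G.lineAnswer l, sum_lineAnswer l,
      fun k => (consistent_cellObs a b l k).mono (hR l k)⟩
  have h01 : G.cellObs a b (0, 1) = G.pauli .Z a := if_pos rfl
  have h10 : G.cellObs a b (1, 0) = G.pauli .X b := by
    rw [cellObs, if_neg (by decide), if_pos rfl]
  rw [h01, h10] at h
  intro q
  linarith [h q]

end CompiledProver

namespace CompiledProver
variable {G : CompiledProver}

/-! ### Amplification from a biased set -/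

/-- Both sides vanish at t = 0. Otherwise the left side is at most 4, while the bias makes the
average on the right at least 2 - 2μ. -/
theorem character_gap {n : ℕ} {μ : ℝ} (hμ : μ < 1) {S : Finset (Bits n)} (hS : S.Nonempty)
    (hb : IsBiased μ S) (e t : Bits n) :
    2 - 2 * (sgn (e ⬝ᵥ t)).re ≤
      2 / (1 - μ) * ((S.card : ℝ)⁻¹ * ∑ a ∈ S, (2 - 2 * (sgn (a ⬝ᵥ t)).re)) := by
  have h1 : 0 < 1 - μ := by linarith
  have hc : (0 : ℝ) < S.card := by exact_mod_cast hS.card_pos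
  by_cases ht : t = 0
  · simp [ht, sgn_zero]
  · have h2 := Complex.abs_re_le_norm (sgn (e ⬝ᵥ t))
    rw [norm_sgn, abs_le] at h2
    have h3 : ((∑ a ∈ S, sgn (a ⬝ᵥ t)) / (S.card : ℂ)).re ≤ μ :=
      ((le_abs_self _).trans (Complex.abs_re_le_norm _)).trans (hb t ht)
    rw [Complex.div_natCast_re, Complex.re_sum] at h3
    have h4 : (S.card : ℝ)⁻¹ * ∑ a ∈ S, (2 - 2 * (sgn (a ⬝ᵥ t)).re) =
        2 - 2 * ((∑ a ∈ S, (sgn (a ⬝ᵥ t)).re) / S.card) := by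
      rw [Finset.sum_sub_distrib, ← Finset.mul_sum, Finset.sum_const, nsmul_eq_mul]
      field_simp
    rw [h4]
    calc 2 - 2 * (sgn (e ⬝ᵥ t)).re ≤ 2 / (1 - μ) * (2 - 2 * μ) := by
          rw [show 2 - 2 * μ = 2 * (1 - μ) by ring]
          field_simp
          linarith [h2.1]
      _ ≤ _ := by gcongr

variable (G) in
/-- Bob's projectors for a pure basis. -/
def pauliProj (W : Basis) (v : Bits G.n) : Matrix (Bits G.P.N) (Bits G.P.N) ℂ :=
  G.P.bobProj (.basis W) v

theorem isProjMeas_pauliProj (W : Basis) : IsProjMeas (G.pauliProj W) :=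
  G.P.isProjMeas_bobProj (.basis W)

theorem obs_pauli (W : Basis) (a : Bits G.n) :
    G.P.obs (G.pauli W a) = ∑ v, sgn (a ⬝ᵥ v) • G.pauliProj W v := rfl

theorem nsq_pauli_mulVec_sub (W : Basis) (a : Bits G.n) (t : Bit) (φ : Bits G.P.N → ℂ) :
    nsq (G.P.obs (G.pauli W a) *ᵥ φ - sgn t • φ) =
      ∑ v, (2 - 2 * (sgn (a ⬝ᵥ v + t)).re) * nsq (G.pauliProj W v *ᵥ φ) :=
  G.P.nsq_obs_mulVec_sub _ _ _

/-- If φ is an eigenvector of all W(a) with eigenvalues (-1)^{a·u}, the relation between W(a) and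
`o` on φ says that `o`φ is an eigenvector with u shifted by b. That defect is a sum over outcomes v
of `character_gap` terms at t = v + u + b, so its average over S controls it for every string e. -/
theorem nrm_amplify {μ : ℝ} (hμ : μ < 1) (hS : G.S.Nonempty) (hb : IsBiased μ G.S)
    (q : G.Query) (W : Basis) {κ : ℝ} (u : G.Branch → Bits G.n)
    (hc : ∀ a, G.Consistent q (G.pauli W a) (fun ω => a ⬝ᵥ u ω) κ) (o : G.Obs) (b e : Bits G.n) :
    G.nrm q (G.P.word [G.pauli W e, o] - sgn (e ⬝ᵥ b) • G.P.word [o, G.pauli W e]) ≤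
      2 * κ + 4 / (1 - μ) * ((G.S.card : ℝ)⁻¹ * ∑ a ∈ G.S, (2 * G.nrm q
        (G.P.word [G.pauli W a, o] - sgn (a ⬝ᵥ b) • G.P.word [o, G.pauli W a]) + 2 * κ)) := by
  have h1 : 0 < 1 - μ := by linarith
  -- The eigenvector defect of `o`φ; up to 2κ and a factor 2 it is equivalent to the norm of the
  -- relation, in both directions.
  let F (a : Bits G.n) : ℝ := G.avg q fun ω =>
    nsq (G.P.obs (G.pauli W a) *ᵥ (G.P.obs o *ᵥ G.branch ω) -
      sgn (a ⬝ᵥ (u ω + b)) • (G.P.obs o *ᵥ G.branch ω))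
  have hv (a : Bits G.n) (ω : G.Branch) :
      (G.P.word [G.pauli W a, o] - sgn (a ⬝ᵥ b) • G.P.word [o, G.pauli W a]) *ᵥ G.branch ω =
        (G.P.obs (G.pauli W a) *ᵥ (G.P.obs o *ᵥ G.branch ω) -
          sgn (a ⬝ᵥ (u ω + b)) • (G.P.obs o *ᵥ G.branch ω)) -
        sgn (a ⬝ᵥ b) • (G.P.obs o *ᵥ (G.P.obs (G.pauli W a) *ᵥ G.branch ω -
          sgn (a ⬝ᵥ u ω) • G.branch ω)) := by
    simp only [Prover.word_cons, Prover.word_nil, Matrix.sub_mulVec, Matrix.mulVec_sub,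
      Matrix.mulVec_smul, Matrix.smul_mulVec, Matrix.mulVec_mulVec, mul_one, smul_sub, smul_smul,
      dotProduct_add, sgn_add, mul_comm (sgn (a ⬝ᵥ u ω))]
    abel
  have hle (a : Bits G.n) : G.nrm q (G.P.word [G.pauli W a, o] -
      sgn (a ⬝ᵥ b) • G.P.word [o, G.pauli W a]) ≤ 2 * F a + 2 * κ := by
    refine le_trans ?_ (add_le_add_right (mul_le_mul_of_nonneg_left (hc a) zero_le_two) _)
    rw [← avg_mul_left, ← avg_mul_left, ← avg_add]
    refine avg_mono _ fun ω => ?_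
    rw [hv]
    refine (nsq_sub_le _ _).trans ?_
    rw [nsq_sgn_smul, Prover.nsq_obs_mulVec]
  have hge (a : Bits G.n) : F a ≤ 2 * G.nrm q (G.P.word [G.pauli W a, o] -
      sgn (a ⬝ᵥ b) • G.P.word [o, G.pauli W a]) + 2 * κ := by
    refine le_trans ?_ (add_le_add_right (mul_le_mul_of_nonneg_left (hc a) zero_le_two) _)
    rw [nrm, ← avg_mul_left, ← avg_mul_left, ← avg_add]
    refine avg_mono _ fun ω => ?_
    have h := nsq_add_le ((G.P.word [G.pauli W a, o] -
      sgn (a ⬝ᵥ b) • G.P.word [o, G.pauli W a]) *ᵥ G.branch ω)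
      (sgn (a ⬝ᵥ b) • (G.P.obs o *ᵥ (G.P.obs (G.pauli W a) *ᵥ G.branch ω -
          sgn (a ⬝ᵥ u ω) • G.branch ω)))
    rw [nsq_sgn_smul, Prover.nsq_obs_mulVec] at h
    rw [hv, sub_add_cancel] at h
    rw [hv]
    exact h
  have hF : F e ≤ 2 / (1 - μ) * ((G.S.card : ℝ)⁻¹ * ∑ a ∈ G.S, F a) := by
    simp only [F]
    rw [← avg_sum, ← avg_mul_left, ← avg_mul_left]
    refine avg_mono _ fun ω => ?_
    simp only [nsq_pauli_mulVec_sub]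
    rw [Finset.sum_comm, Finset.mul_sum, Finset.mul_sum]
    refine Finset.sum_le_sum fun v _ => ?_
    rw [← Finset.sum_mul, ← mul_assoc, ← mul_assoc]
    refine mul_le_mul_of_nonneg_right ?_ (nsq_nonneg _)
    have h := character_gap hμ hS hb e (v + (u ω + b))
    simp only [dotProduct_add] at h ⊢
    rw [mul_assoc]
    exact h
  calc _ ≤ 2 * F e + 2 * κ := hle e
    _ ≤ 2 * (2 / (1 - μ) * ((G.S.card : ℝ)⁻¹ * ∑ a ∈ G.S, F a)) + 2 * κ := by linarith
    _ = 2 * κ + 4 / (1 - μ) * ((G.S.card : ℝ)⁻¹ * ∑ a ∈ G.S, F a) := by ring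
    _ ≤ _ := by
      gcongr with a ha
      exact hge a

theorem inv_card_mul_sum_add_mul {α : Type} (S : Finset α) (hS : S.Nonempty) (f : α → ℝ)
    (c d : ℝ) : (S.card : ℝ)⁻¹ * ∑ a ∈ S, (c * f a + d) =
      c * ((S.card : ℝ)⁻¹ * ∑ a ∈ S, f a) + d := by
  have hc : (0 : ℝ) < S.card := by exact_mod_cast hS.card_pos
  rw [Finset.sum_add_distrib, Finset.sum_const, nsmul_eq_mul, ← Finset.mul_sum]
  field_simp

theorem rel_pauli_amplify {K : ℕ} {δ : ℝ} (hG : G.Indist K δ) (hK : 4 ≤ K) {μ : ℝ} (hμ : μ < 1)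
    (hS : G.S.Nonempty) (hb : IsBiased μ G.S) (W : Basis) (o : G.Obs) (b : Bits G.n) {κ : ℝ}
    (hκ : 4 * G.rej (.basis W) (.basis W) ≤ κ) (f : Bits G.n → ℝ)
    (h : ∀ a ∈ G.S, G.Rel [G.pauli W a, o] (a ⬝ᵥ b) [o, G.pauli W a] (f a)) (e : Bits G.n) :
    G.Rel [G.pauli W e, o] (e ⬝ᵥ b) [o, G.pauli W e]
      (2 * κ + 4 / (1 - μ) * (2 * ((G.S.card : ℝ)⁻¹ * ∑ a ∈ G.S, f a) + 2 * κ) + δ) := by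
  have h1 : 0 < 1 - μ := by linarith
  refine hG.rel (.basis W) ((nrm_amplify hμ hS hb _ W G.answerBits
    (fun a => (consistent_pauli W a).mono hκ) o b e).trans ?_) hK
  rw [← inv_card_mul_sum_add_mul _ hS]
  gcongr with a ha
  exact h a ha _

/-- The amplification is applied twice, first to the Z string with the X string fixed in S, then to
the X string. It is linear in the error, so only the average over S × S enters. -/
theorem rel_pauli {K : ℕ} {δ : ℝ} (hG : G.Indist K δ) (hδ : 0 ≤ δ) (hK : 5 ≤ K) {μ : ℝ}
    (hμ : μ < 1) (hS : G.S.Nonempty) (hb : IsBiased μ G.S) {ε κ : ℝ}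
    (hε : expect (pauliBraidingDist G.S hS) (fun xy => G.rej xy.1 xy.2) ≤ ε)
    (hκ : ∀ W, 4 * G.rej (.basis W) (.basis W) ≤ κ) (d e : Bits G.n) :
    G.Rel [G.pauli .X d, G.pauli .Z e] (d ⬝ᵥ e) [G.pauli .Z e, G.pauli .X d]
      (2 * κ + 4 / (1 - μ) * (2 * (2 * κ + 4 / (1 - μ) * (2 * (50400 * ε + 80 * δ) + 2 * κ) + δ)
        + 2 * κ) + δ) := by
  have h1 : 0 < 1 - μ := by linarith
  have : Nonempty G.S := hS.to_subtype
  let R (ab : G.S × G.S) : ℝ := expect (if ab.1.1 ⬝ᵥ ab.2.1 = 0 then commutationDist ab.1 ab.2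
    else anticommutationDist ab.1 ab.2) fun xy => G.rej xy.1 xy.2
  have hR (ab : G.S × G.S) : 0 ≤ R ab := expect_nonneg _ fun xy => G.rej_nonneg _ _
  have hbase (a b : G.S) : G.Rel [G.pauli .Z a, G.pauli .X b] (a.1 ⬝ᵥ b.1)
      [G.pauli .X b, G.pauli .Z a] (50400 * R (a, b) + 80 * δ) := by
    rcases bit_cases (a.1 ⬝ᵥ b.1) with h | h
    · have hRe : R (a, b) = expect (commutationDist a b) fun xy => G.rej xy.1 xy.2 := by
        simp only [R]
        rw [if_pos h]
      have := rel_pauli_of_commutation hG (by omega) a b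
      rw [← hRe] at this
      rw [h]
      intro q
      linarith [this q, hR (a, b)]
    · have hRe : R (a, b) = expect (anticommutationDist a b) fun xy => G.rej xy.1 xy.2 := by
        simp only [R]
        rw [if_neg (by rw [h]; decide)]
      have := rel_pauli_of_anticommutation hG hK a b
      rw [← hRe] at this
      rwa [h]
  have hmean : (G.S.card : ℝ)⁻¹ * ∑ b : G.S, ((G.S.card : ℝ)⁻¹ * ∑ a : G.S, R (a, b)) ≤ ε := by
    refine le_trans (le_of_eq ?_) hε
    rw [pauliBraidingDist, expect_bind, expect_uniform, Fintype.card_prod, Fintype.card_coe,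
      Fintype.sum_prod_type_right, ← Finset.mul_sum, ← mul_assoc]
    push_cast
    rw [mul_inv]
  -- The average over the Z string; the value 0 outside S is never used.
  let f (b : Bits G.n) : ℝ := if hbS : b ∈ G.S then
    (G.S.card : ℝ)⁻¹ * ∑ a : G.S, R (a, ⟨b, hbS⟩) else 0
  have hf (b : G.S) : f b = (G.S.card : ℝ)⁻¹ * ∑ a : G.S, R (a, b) := dif_pos b.2
  have hZ (b : Bits G.n) (hbS : b ∈ G.S) (e : Bits G.n) :
      G.Rel [G.pauli .X b, G.pauli .Z e] (b ⬝ᵥ e) [G.pauli .Z e, G.pauli .X b]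
        (2 * κ + 4 / (1 - μ) * (2 * (50400 * f b + 80 * δ) + 2 * κ) + δ) := by
    have := (rel_pauli_amplify hG (by omega) hμ hS hb .Z (G.pauli .X b) b (hκ .Z)
      (fun a => if haS : a ∈ G.S then 50400 * R (⟨a, haS⟩, ⟨b, hbS⟩) + 80 * δ else 0)
      (fun a haS => by
        rw [dif_pos haS]
        exact hbase ⟨a, haS⟩ ⟨b, hbS⟩) e).symm
    rw [dotProduct_comm b e]
    refine fun q => (this q).trans (le_of_eq ?_)
    rw [← Finset.sum_coe_sort]
    simp only [Subtype.coe_eta, Finset.coe_mem, dif_pos]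
    have hm := inv_card_mul_sum_add_mul (Finset.univ : Finset G.S) Finset.univ_nonempty
      (fun a => R (a, ⟨b, hbS⟩)) 50400 (80 * δ)
    rw [Finset.card_univ, Fintype.card_coe] at hm
    rw [hm, ← hf ⟨b, hbS⟩]
  refine fun q => (rel_pauli_amplify hG (by omega) hμ hS hb .X (G.pauli .Z e) e (hκ .X) _
    (fun a haS => hZ a haS e) d q).trans ?_
  have hfm : (G.S.card : ℝ)⁻¹ * ∑ b ∈ G.S, f b ≤ ε := by
    rw [← Finset.sum_coe_sort]
    simp only [hf]
    exact hmean
  have hlin (b : Bits G.n) : 2 * κ + 4 / (1 - μ) * (2 * (50400 * f b + 80 * δ) + 2 * κ) + δ =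
      (4 / (1 - μ) * (2 * 50400)) * f b +
        (2 * κ + 4 / (1 - μ) * (2 * (80 * δ) + 2 * κ) + δ) := by ring
  simp only [hlin]
  rw [inv_card_mul_sum_add_mul _ hS]
  calc _ ≤ 2 * κ + 4 / (1 - μ) * (2 * ((4 / (1 - μ) * (2 * 50400)) * ε +
        (2 * κ + 4 / (1 - μ) * (2 * (80 * δ) + 2 * κ) + δ)) + 2 * κ) + δ := by gcongr
    _ = _ := by ring

end CompiledProver

/-! ### Pauli strings and the swap isometry -/

/-- The part of `a` at the positions where `w` has the letter of `W`. -/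
def maskBits {n : ℕ} (W : Basis) (w : PauliString n) (a : Bits n) : Bits n :=
  fun i => if w i = W.toPauli then a i else 0

theorem Pauli.mat_pow_apply (p : Pauli) (b x y : Bit) :
    (p.mat ^ b.val) x y = if x = y + (if p = .X then b else 0)
      then sgn ((if p = .Z then b else 0) * y) else 0 := by
  have h0 : (0 : Bit).val = 0 := rfl
  have h1 : (1 : Bit).val = 1 := rfl
  have h01 : (0 : Bit) ≠ 1 := by decide
  have h11 : (1 : Bit) + 1 = 0 := by decide
  rcases bit_cases b with rfl | rfl
  · rw [h0, pow_zero]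
    simp [Matrix.one_apply, sgn_zero]
  · rw [h1, pow_one]
    cases p
    · simp [Pauli.mat, Matrix.one_apply, sgn_zero]
    · rcases bit_cases x with rfl | rfl <;> rcases bit_cases y with rfl | rfl <;>
        simp only [Pauli.mat, Matrix.of_apply, h11, h01, h01.symm, zero_add, sgn_zero, if_true,
          if_false, zero_mul, reduceCtorEq]
    · simp only [Pauli.mat, Matrix.diagonal_apply, reduceCtorEq, if_false, add_zero, if_true,
        one_mul]
      split_ifs with h
      · rw [h]
      · rfl

/-- σ_w(a) maps |y⟩ to (-1)^{c·y}|y + d⟩, with d and c the X- and Z-parts of a. No position carries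
both letters, so no ordering sign appears. -/
theorem pauliObs_apply {n : ℕ} (w : PauliString n) (a x y : Bits n) :
    pauliObs w a x y = if x = y + maskBits .X w a then sgn (maskBits .Z w a ⬝ᵥ y) else 0 := by
  simp only [pauliObs, Matrix.of_apply, Pauli.mat_pow_apply]
  rw [Finset.prod_ite_zero, dotProduct, sgn_sum]
  simp only [Finset.mem_univ, true_implies, funext_iff, Pi.add_apply, maskBits, Basis.toPauli]
  congr

/-- If t_i = 1, translating e by the i-th unit vector negates every term. -/
theorem sum_sgn_dotProduct {n : ℕ} (t : Bits n) :
    ∑ e : Bits n, sgn (e ⬝ᵥ t) = if t = 0 then (Fintype.card (Bits n) : ℂ) else 0 := by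
  split_ifs with ht
  · simp [ht, sgn_zero]
  · obtain ⟨i, hi⟩ : ∃ i, t i ≠ 0 := by
      by_contra! h
      exact ht (funext h)
    have hi1 : t i = 1 := (bit_cases _).resolve_left hi
    have h := Equiv.sum_comp (Equiv.addRight (Pi.single i 1 : Bits n)) fun e => sgn (e ⬝ᵥ t)
    simp only [Equiv.coe_addRight, add_dotProduct, single_dotProduct, hi1, mul_one, sgn_add,
      sgn_one, mul_neg, Finset.sum_neg_distrib] at h
    exact self_eq_neg.mp h.symm

theorem conjTranspose_stack_mul_kronecker_mul_stack {α ι κ : Type} [Fintype α] [Fintype κ]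
    [DecidableEq κ] (A : α → Matrix κ ι ℂ) (M : Matrix α α ℂ) :
    (Matrix.of fun (p : α × κ) j => A p.1 p.2 j)ᴴ * (M ⊗ₖ (1 : Matrix κ κ ℂ)) *
      (Matrix.of fun (p : α × κ) j => A p.1 p.2 j) =
      ∑ x, ∑ y, M x y • ((A x)ᴴ * A y) := by
  ext i j
  simp only [Matrix.mul_apply, Matrix.sum_apply, Matrix.smul_apply, Fintype.sum_prod_type,
    Matrix.kroneckerMap_apply, Matrix.one_apply, Matrix.conjTranspose_apply, Matrix.of_apply,
    mul_ite, mul_one, mul_zero, Finset.sum_ite_eq', Finset.mem_univ, if_true, smul_eq_mul,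
    Finset.mul_sum, Finset.sum_mul]
  rw [Finset.sum_comm_cycle]
  refine Finset.sum_congr rfl fun x _ => ?_
  refine Finset.sum_congr rfl fun y _ => Finset.sum_congr rfl fun k _ => ?_
  ring

namespace CompiledProver
variable (G : CompiledProver)

/-- The operator `∑_y (-1)^{c·y} P_{y+d} X(d) P_y`, where `P` is the measurement in the
`Z` basis. -/
noncomputable def twirl (d c : Bits G.n) : Matrix (Bits G.P.N) (Bits G.P.N) ℂ :=
  ∑ y, sgn (c ⬝ᵥ y) • (G.pauliProj .Z (y + d) * G.P.obs (G.pauli .X d) * G.pauliProj .Z y)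

/-- The blocks of V are X(x)P_x, and the auxiliary space is a copy of the prover's space. Since
X(x)X(y) = X(x + y), the pullback of |x⟩⟨y| ⊗ 1 is P_x X(x + y) P_y. These identities are exact,
using only that each basis is measured projectively. -/
theorem exists_isometry :
    ∃ (d : ℕ) (V : Matrix (Bits G.n × Fin d) (Bits G.P.N) ℂ), Vᴴ * V = 1 ∧
      ∀ w a, Vᴴ * (pauliObs w a ⊗ₖ (1 : Matrix (Fin d) (Fin d) ℂ)) * V =
        G.twirl (maskBits .X w a) (maskBits .Z w a) := by
  let e := (Fintype.equivFin (Bits G.P.N)).symm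
  let A (x : Bits G.n) : Matrix (Fin (Fintype.card (Bits G.P.N))) (Bits G.P.N) ℂ :=
    (G.P.obs (G.pauli .X x) * G.pauliProj .Z x).submatrix e id
  have hA (x y : Bits G.n) : (A x)ᴴ * A y =
      G.pauliProj .Z x * G.P.obs (G.pauli .X (x + y)) * G.pauliProj .Z y := by
    have hxy : G.P.obs (G.pauli .X x) * G.P.obs (G.pauli .X y) = G.P.obs (G.pauli .X (x + y)) :=
      G.P.obs_mul_obs _ _ _
    simp only [A]
    rw [Matrix.conjTranspose_submatrix, Matrix.submatrix_mul_equiv, Matrix.submatrix_id_id,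
      Matrix.conjTranspose_mul, G.P.conjTranspose_obs, (isProjMeas_pauliProj .Z).herm, ← hxy]
    simp only [Matrix.mul_assoc]
  have hadd (y d : Bits G.n) : y + d + y = d := by
    funext i
    have := bit_add_self (y i)
    simp only [Pi.add_apply]
    grind
  refine ⟨_, Matrix.of fun p j => A p.1 p.2 j, ?_, fun w a => ?_⟩
  · have h := conjTranspose_stack_mul_kronecker_mul_stack A 1
    rw [Matrix.one_kronecker_one, Matrix.mul_one] at h
    rw [h, ← (isProjMeas_pauliProj (G := G) .Z).sum]
    refine Finset.sum_congr rfl fun x _ => ?_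
    rw [Finset.sum_eq_single x]
    · have h0 : G.P.obs (G.pauli .X (x + x)) = 1 := by
        rw [show x + x = 0 from funext fun i => bit_add_self (x i)]
        exact G.P.obs_zero _
      rw [hA, h0, Matrix.one_apply_eq, one_smul, Matrix.mul_one,
        (isProjMeas_pauliProj .Z).mul, if_pos rfl]
    · intro y _ hy
      rw [Matrix.one_apply_ne hy.symm, zero_smul]
    · simp
  · rw [conjTranspose_stack_mul_kronecker_mul_stack, Finset.sum_comm, twirl]
    refine Finset.sum_congr rfl fun y _ => ?_
    rw [Finset.sum_eq_single (y + maskBits .X w a)]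
    · rw [hA, hadd, pauliObs_apply, if_pos rfl]
    · intro x _ hx
      rw [pauliObs_apply, if_neg hx, zero_smul]
    · simp

/-- Averaging (-1)^{e·(d+v+y)} over e selects v = y + d. This writes the pullback as an average of
words of length four, the only form in which indistinguishability applies to it. -/
theorem twirl_eq (d c : Bits G.n) :
    G.twirl d c = (Fintype.card (Bits G.n) : ℂ)⁻¹ • ∑ e, sgn (d ⬝ᵥ e) •
      G.P.word [G.pauli .Z e, G.pauli .X d, G.pauli .Z e, G.pauli .Z c] := by
  have hM := isProjMeas_pauliProj (G := G) .Z
  have hc : (Fintype.card (Bits G.n) : ℂ) ≠ 0 := by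
    exact_mod_cast Fintype.card_ne_zero
  have hadd (d v y : Bits G.n) : d + v + y = 0 ↔ v = y + d := by
    simp only [funext_iff, Pi.add_apply, Pi.zero_apply]
    refine forall_congr' fun i => ?_
    generalize d i = a, v i = b, y i = c
    revert a b c
    decide
  have hw (e : Bits G.n) : sgn (d ⬝ᵥ e) •
      G.P.word [G.pauli .Z e, G.pauli .X d, G.pauli .Z e, G.pauli .Z c] =
      ∑ y, ∑ v, (sgn (e ⬝ᵥ (d + v + y)) * sgn (c ⬝ᵥ y)) •
        (G.pauliProj .Z v * G.P.obs (G.pauli .X d) * G.pauliProj .Z y) := by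
    simp only [Prover.word_cons, Prover.word_nil, mul_one]
    rw [obs_pauli .Z e, obs_pauli .Z c, hM.sum_smul_mul_sum_smul, Finset.sum_mul, Finset.smul_sum,
      Finset.sum_comm]
    refine Finset.sum_congr rfl fun v _ => ?_
    rw [Finset.mul_sum, Finset.mul_sum, Finset.smul_sum]
    refine Finset.sum_congr rfl fun y _ => ?_
    rw [mul_smul_comm, smul_mul_smul_comm, smul_smul, dotProduct_add, dotProduct_add, sgn_add,
      sgn_add, dotProduct_comm d e, Matrix.mul_assoc]
    congr 1
    ring
  simp only [hw]
  rw [Finset.sum_comm, Finset.smul_sum, twirl]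
  refine Finset.sum_congr rfl fun y _ => ?_
  rw [Finset.sum_comm]
  simp only [← Finset.sum_smul, ← Finset.sum_mul, sum_sgn_dotProduct, hadd, ite_mul, zero_mul,
    ite_smul, zero_smul, Finset.sum_ite_eq', Finset.mem_univ, if_true]
  rw [smul_smul, inv_mul_cancel_left₀ hc]

/-- The X- and Z-parts belong to one projective measurement, so they multiply exactly; zeroing the
ignored outcome bits is the same as dropping those positions from a. -/
theorem mixedObs_eq (w : PauliString G.n) (a : Bits G.n) :
    G.P.mixedObs w a =
      G.P.word [⟨.mixed w, maskBits .X w a⟩, ⟨.mixed w, maskBits .Z w a⟩] := by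
  have h : G.P.word [⟨.mixed w, maskBits .X w a⟩, ⟨.mixed w, maskBits .Z w a⟩] =
      G.P.obs ⟨.mixed w, maskBits .X w a + maskBits .Z w a⟩ := by
    simp only [Prover.word_cons, Prover.word_nil, mul_one]
    exact G.P.obs_mul_obs _ _ _
  rw [h, Prover.mixedObs]
  simp only [Prover.mixedProj, Finset.smul_sum, smul_ite, smul_zero]
  rw [Finset.sum_comm]
  simp only [Finset.sum_ite_eq, Finset.mem_univ, if_true]
  refine Finset.sum_congr rfl fun v _ => ?_
  congr 2
  refine Finset.sum_congr rfl fun i _ => ?_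
  simp only [Pi.add_apply, maskBits, Basis.toPauli]
  cases w i <;> simp

variable {G}

theorem nrm_average_le {β : Type} [Fintype β] [Nonempty β] (q : G.Query)
    (R : β → Matrix (Bits G.P.N) (Bits G.P.N) ℂ) {e : ℝ} (h : ∀ j, G.nrm q (R j) ≤ e) :
    G.nrm q ((Fintype.card β : ℂ)⁻¹ • ∑ j, R j) ≤ e := by
  have hc : (0 : ℝ) < Fintype.card β := by exact_mod_cast Fintype.card_pos
  calc _ ≤ G.avg q fun ω => (Fintype.card β : ℝ)⁻¹ * ∑ j, nsq (R j *ᵥ G.branch ω) := by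
        refine avg_mono _ fun ω => ?_
        rw [Matrix.smul_mulVec, Matrix.sum_mulVec]
        exact nsq_average_le _
    _ = (Fintype.card β : ℝ)⁻¹ * ∑ j, G.nrm q (R j) := by
        rw [avg_mul_left, avg_sum]
        rfl
    _ ≤ (Fintype.card β : ℝ)⁻¹ * ∑ _j : β, e := by
        gcongr with j _
        exact h j
    _ = e := by
        rw [Finset.sum_const, Finset.card_univ, nsmul_eq_mul, inv_mul_cancel_left₀ hc.ne']

/-- Each of the 2^n terms of the average is compared with X(d)Z(c) separately and convexity does the
rest, so the twirl itself never has to be implemented efficiently. -/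
theorem nrm_sub_twirl_le {K : ℕ} {δ g κ : ℝ} (hG : G.Indist K δ) (hK : 6 ≤ K) (d c : Bits G.n)
    (hκ : 4 * G.rej (.basis .Z) (.basis .Z) ≤ κ)
    (hg : ∀ e, G.Rel [G.pauli .X d, G.pauli .Z e] (d ⬝ᵥ e) [G.pauli .Z e, G.pauli .X d] g)
    (q : G.Query) :
    G.nrm q (G.P.word [G.pauli .X d, G.pauli .Z c] - G.twirl d c) ≤ 2 * g + 8 * κ + δ := by
  have hc : (Fintype.card (Bits G.n) : ℂ) ≠ 0 := by
    exact_mod_cast Fintype.card_ne_zero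
  -- The compared words have lengths 2 and 4, which is where word length 6 is needed.
  have hterm (e : Bits G.n) : G.Rel [G.pauli .X d, G.pauli .Z c] (d ⬝ᵥ e)
      [G.pauli .Z e, G.pauli .X d, G.pauli .Z e, G.pauli .Z c] (2 * g + 8 * κ + δ) := by
    have h1 : G.Rel [G.pauli .X d] (d ⬝ᵥ e)
        [G.pauli .Z e, G.pauli .X d, G.pauli .Z e] g := fun q => by
      have hw : G.P.word [G.pauli .Z e, G.pauli .Z e, G.pauli .X d] =
          G.P.word [G.pauli .X d] := by
        simp only [Prover.word_cons, Prover.word_nil, mul_one]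
        rw [← mul_assoc, Prover.obs_mul_self, one_mul]
      have := ((hg e).cons (G.pauli .Z e)).symm q
      rwa [hw] at this
    exact h1.concat hG ((consistent_pauli .Z c).mono hκ) hK
  have hw : G.P.word [G.pauli .X d, G.pauli .Z c] - G.twirl d c =
      (Fintype.card (Bits G.n) : ℂ)⁻¹ • ∑ e, (G.P.word [G.pauli .X d, G.pauli .Z c] -
        sgn (d ⬝ᵥ e) •
          G.P.word [G.pauli .Z e, G.pauli .X d, G.pauli .Z e, G.pauli .Z c]) := by
    rw [twirl_eq, Finset.sum_sub_distrib, smul_sub, Finset.sum_const, Finset.card_univ,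
      ← Nat.cast_smul_eq_nsmul ℂ, smul_smul, inv_mul_cancel₀ hc, one_smul]
  rw [hw]
  exact nrm_average_le q _ fun e => hterm e q

/-- The right letter is replaced first, for free under left multiplication; the left letter then has
Z(c) to its right, whose consistency `Rel.concat` uses. -/
theorem nrm_word_sub_twirl_le {K : ℕ} {δ g κ : ℝ} (hG : G.Indist K δ) (hK : 6 ≤ K)
    (hκ : 4 * G.rej (.basis .Z) (.basis .Z) ≤ κ) {d c : Bits G.n}
    (hg : ∀ e, G.Rel [G.pauli .X d, G.pauli .Z e] (d ⬝ᵥ e) [G.pauli .Z e, G.pauli .X d] g)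
    {o o' : G.Obs} {e e' : ℝ} (hX : G.Rel [o] 0 [G.pauli .X d] e)
    (hZ : G.Rel [o'] 0 [G.pauli .Z c] e') (q : G.Query) :
    G.nrm q (G.P.word [o, o'] - G.twirl d c) ≤
      3 * (e' + (2 * e + 8 * κ + δ) + (2 * g + 8 * κ + δ)) := by
  have h1 := hZ.cons o q
  have h2 : G.Rel [o, G.pauli .Z c] 0 [G.pauli .X d, G.pauli .Z c] _ :=
    Rel.concat hG hX ((consistent_pauli .Z c).mono hκ) (by simp; omega)
  have h2 := h2 q
  have h3 := nrm_sub_twirl_le hG hK d c hκ hg q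
  rw [sgn_zero, one_smul] at h1 h2
  have h := nrm_add_three_le q
    (G.P.word [o, o'] - G.P.word [o, G.pauli .Z c])
    (G.P.word [o, G.pauli .Z c] - G.P.word [G.pauli .X d, G.pauli .Z c])
    (G.P.word [G.pauli .X d, G.pauli .Z c] - G.twirl d c)
  rw [sub_add_sub_cancel, sub_add_sub_cancel] at h
  linarith

theorem nrm_mixedObs_sub_twirl_le {K : ℕ} {δ g κ : ℝ} (hG : G.Indist K δ) (hK : 6 ≤ K)
    (hκ : ∀ W, 4 * G.rej (.basis W) (.basis W) ≤ κ)
    (hg : ∀ d e, G.Rel [G.pauli .X d, G.pauli .Z e] (d ⬝ᵥ e) [G.pauli .Z e, G.pauli .X d] g)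
    (w : PauliString G.n) (a : Bits G.n) (q : G.Query) :
    G.nrm q (G.P.mixedObs w a - G.twirl (maskBits .X w a) (maskBits .Z w a)) ≤
      24 * G.rej (.basis .Z) (.mixed w) + 48 * G.rej (.basis .X) (.mixed w) + 6 * g +
        66 * κ + 15 * δ := by
  have hmask (W : Basis) : G.Rel [⟨.mixed w, maskBits W w a⟩] 0 [G.pauli W (maskBits W w a)]
      (2 * (4 * G.rej (.basis W) (.mixed w)) + 2 * κ + δ) :=
    hG.rel (.basis W) ((consistent_mixed W w (maskBits W w a) fun i hi => if_neg hi).nrm_sub_le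
      ((consistent_pauli W _).mono (hκ W))) (by simp; omega)
  rw [mixedObs_eq]
  refine (nrm_word_sub_twirl_le hG hK (hκ .Z) (hg _) (hmask .X) (hmask .Z) q).trans
    (le_of_eq ?_)
  ring

theorem exists_isometry_of_winProb {K : ℕ} {δ : ℝ} (hG : G.Indist K δ) (hδ : 0 ≤ δ) (hK : 6 ≤ K)
    {μ : ℝ} (hμ : μ < 1) (hS : G.S.Nonempty) (hb : IsBiased μ G.S) (D : PMF (PauliString G.n))
    {ε : ℝ} (h₁ : 1 - ε ≤ winProb G.E G.lam G.encode G.P (pauliBraidingDist G.S hS))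
    (h₂ : 1 - ε ≤ winProb G.E G.lam G.encode G.P (mixedPureDist G.S D)) :
    ∃ (d : ℕ) (V : Matrix (Bits G.n × Fin d) (Bits G.P.N) ℂ), Vᴴ * V = 1 ∧ ∀ q : G.Query,
      expect D (fun w => expect (PMF.uniformOfFintype (Bits G.n)) fun a =>
        stateNormSq (G.P.mixedObs w a
            - Vᴴ * (pauliObs w a ⊗ₖ (1 : Matrix (Fin d) (Fin d) ℂ)) * V)
          (encState G.E G.lam G.encode G.P q)) ≤
        (1536 + 576 * (4 / (1 - μ)) + 1209984 * (4 / (1 - μ)) ^ 2) * ε +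
          (21 + 12 * (4 / (1 - μ)) + 1920 * (4 / (1 - μ)) ^ 2) * δ := by
  rw [winProb_eq] at h₁ h₂
  have h₁ : expect (pauliBraidingDist G.S hS) (fun xy => G.rej xy.1 xy.2) ≤ ε := by linarith
  have h₂ : expect (mixedPureDist G.S D) (fun xy => G.rej xy.1 xy.2) ≤ ε := by linarith
  rw [mixedPureDist, expect_bind] at h₂
  have h4 (Wb : Basis × Bool) := (le_card_mul_expect_uniform (fun Wb : Basis × Bool =>
    expect (if Wb.2 then D.map fun w => ((.basis Wb.1, .mixed w) : G.Query × BobQ G.n G.S)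
      else PMF.pure (.basis Wb.1, .basis Wb.1)) fun xy => G.rej xy.1 xy.2)
      (fun Wb => expect_nonneg _ fun _ => G.rej_nonneg _ _) Wb).trans
    (mul_le_mul_of_nonneg_left h₂ (Nat.cast_nonneg _))
  have hcard : Fintype.card (Basis × Bool) = 4 := rfl
  simp only [hcard] at h4
  push_cast at h4
  -- Each basis and each of the two subtests together have probability 1/4.
  have hpure (W : Basis) : 4 * G.rej (.basis W) (.basis W) ≤ 16 * ε := by
    have := h4 (W, false)
    simp only [Bool.false_eq_true, if_false, expect_pure] at this
    linarith
  have hmixed (W : Basis) : expect D (fun w => G.rej (.basis W) (.mixed w)) ≤ 4 * ε := by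
    have := h4 (W, true)
    simpa only [if_true, expect_map] using this
  obtain ⟨dim, V, hV, hVw⟩ := G.exists_isometry
  refine ⟨dim, V, hV, fun q => ?_⟩
  simp only [hVw, stateNormSq_encState]
  have hg := rel_pauli hG hδ (by omega) hμ hS hb h₁ hpure
  refine (expect_mono D fun w => (expect_mono _ fun a =>
    nrm_mixedObs_sub_twirl_le hG hK hpure hg w a q).trans_eq (expect_const _ _)).trans ?_
  simp only [expect_add, expect_mul_left, expect_const]
  have hX := hmixed .X
  have hZ := hmixed .Z
  generalize 4 / (1 - μ) = c
  nlinarith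

end CompiledProver

/-! ### Conclusion in the security parameter -/

theorem min_one_le_sqrt (x : ℝ) : min x 1 ≤ √x := by
  rcases le_total x 1 with h | h
  · rw [min_eq_left h]
    rcases le_total x 0 with h0 | h0
    · exact h0.trans (Real.sqrt_nonneg x)
    · exact Real.le_sqrt_of_sq_le (by nlinarith)
  · rw [min_eq_right h]
    exact Real.one_le_sqrt.mpr h

theorem mainTheorem3 (μ : ℝ) (hμ : μ < 1) :
    ∃ C : ℝ, ∀ (E : EncryptionScheme), E.IsINDCPA →
      ∀ (n : ℕ → ℕ) (S : (lam : ℕ) → Finset (Bits (n lam))) (hS : ∀ lam, (S lam).Nonempty),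
      (∀ lam, IsBiased μ (S lam)) →
      ∀ (D : (lam : ℕ) → PMF (PauliString (n lam)))
        (m : ℕ → ℕ) (encode : (lam : ℕ) → AliceQ (n lam) (S lam) → Bits (m lam)),
      PolyBounded m →
      ∀ (P : (lam : ℕ) → Prover (n lam) (S lam) (E.ctLen lam (m lam))),
      EfficientProver P →
      ∀ ε : ℕ → ℝ,
      (∀ lam, 1 - ε lam ≤
        winProb E lam (encode lam) (P lam) (pauliBraidingDist (S lam) (hS lam))) →
      (∀ lam, 1 - ε lam ≤
        winProb E lam (encode lam) (P lam) (mixedPureDist (S lam) (D lam))) →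
      ∃ η : ℕ → ℝ, Negligible η ∧ ∀ lam,
        ∃ (d : ℕ) (V : Matrix (Bits (n lam) × Fin d) (Bits (P lam).N) ℂ), Vᴴ * V = 1 ∧
          ∀ q : AliceQ (n lam) (S lam),
            expect (D lam) (fun w => expect (PMF.uniformOfFintype (Bits (n lam))) fun a =>
              stateNormSq ((P lam).mixedObs w a
                  - Vᴴ * (pauliObs w a ⊗ₖ (1 : Matrix (Fin d) (Fin d) ℂ)) * V)
                (encState E lam (encode lam) (P lam) q))
              ≤ C * √(ε lam) + η lam := by
  have hμ' : 0 < 1 - μ := by linarith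
  refine ⟨1536 + 576 * (4 / (1 - μ)) + 1209984 * (4 / (1 - μ)) ^ 2, ?_⟩
  intro E hE n S hS hb D m encode hm P hP ε h₁ h₂
  obtain ⟨δ, hδ, hG⟩ := exists_negligible_indist E hE n m S encode hm P hP 6
  refine ⟨fun lam => (21 + 12 * (4 / (1 - μ)) + 1920 * (4 / (1 - μ)) ^ 2) * δ lam,
    hδ.const_mul _, fun lam => ?_⟩
  let G : CompiledProver := ⟨E, lam, n lam, m lam, S lam, encode lam, P lam⟩
  -- Winning probabilities are nonnegative, so ε may be replaced by min(ε, 1), which is at most √ε.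
  have hwin (dist : PMF (AliceQ (n lam) (S lam) × BobQ (n lam) (S lam))) :
      0 ≤ winProb E lam (encode lam) (P lam) dist := by
    have h := CompiledProver.winProb_eq G dist
    have h' := (expect_mono dist fun xy => G.rej_le_one xy.1 xy.2).trans_eq (expect_const dist 1)
    exact (sub_nonneg.mpr h').trans_eq h.symm
  have hε (dist : PMF (AliceQ (n lam) (S lam) × BobQ (n lam) (S lam)))
      (h : 1 - ε lam ≤ winProb E lam (encode lam) (P lam) dist) :
      1 - min (ε lam) 1 ≤ winProb E lam (encode lam) (P lam) dist := by
    rcases min_choice (ε lam) 1 with h' | h' <;> rw [h']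
    · exact h
    · linarith [hwin dist]
  obtain ⟨d, V, hV, hbound⟩ := CompiledProver.exists_isometry_of_winProb (G := G) (hG lam).2
    (hG lam).1 le_rfl hμ (hS lam) (hb lam) (D lam) (hε _ (h₁ lam)) (hε _ (h₂ lam))
  refine ⟨d, V, hV, fun q => (hbound q).trans ?_⟩
  gcongr
  exact min_one_le_sqrt (ε lam)
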